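/- Let $n\ge 1$, $\alpha\in(0,1)$, $\lambda>1$, $V\ge 0$ and $1<q<\infty$. Write $e^{-t(-\Delta)^\alpha}(x)=(2\pi)^{-n}\int_{\mathbb R^n}e^{i x\cdot\xi}e^{-t|\xi|^{2\alpha}}\,d\xi$ for the kernel of the fractional heat semigroup on $\mathbb R^n$ and $e^{-t(-\Delta)^\alpha}f(x)=\int_{\mathbb R^n}e^{-t(-\Delta)^\alpha}(x-y)f(y)\,dy$. For a sequence $a=(a_j)_{j\in\mathbb Z}$ of positive numbers, a real sequence $v=(v_j)_{j\in\mathbb Z}$ and integers $N_1\le N_2$ put $$T_{(N_1,N_2)}f(x)=\sum_{j=N_1}^{N_2}v_j\bigl(e^{-a_{j+1}(-\Delta)^\alpha}f(x)-e^{-a_j(-\Delta)^\alpha}f(x)\bigr),\qquad T_M^*f(x)=\sup_{-M\le N_1<N_2\le M}|T_{(N_1,N_2)}f(x)|,$$ and let $$\mathcal M g(x)=\sup_{r>0}\frac1{|B(x,r)|}\int_{B(x,r)}|g(y)|\,dy,\qquad \mathcal M_q f(x)=\sup_{r>0}\Bigl(\frac1{|B(x,r)|}\int_{B(x,r)}|f(y)|^q\,dy\Bigr)^{1/q}.$$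 There is a finite constant $C$, depending only on $n$, $\alpha$, $\lambda$, $V$ and $q$, such that for every sequence $a$ of positive numbers with $a_{j+1}/a_j\ge\lambda$ for all $j\in\mathbb Z$, every $v$ with $\|v\|_{\ell^\infty(\mathbb Z)}\le V$, every measurable real- or complex-valued function $f$ on $\mathbb R^n$, every $x\in\mathbb R^n$ and every integer $M\ge 1$, $$T_M^*f(x)\le C\bigl\{\mathcal M(T_{(-M,M)}f)(x)+\mathcal M_qf(x)\bigr\}.$$ (The maximal functions take values in $[0,\infty]$; if $\mathcal M_qf(x)=\infty$ the right-hand side is $\infty$ and nothing is claimed, and if $\mathcal M_qf(x)<\infty$ for some $x$, all the integrals defining $e^{-t(-\Delta)^\alpha}f$ converge absolutely.) -/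

import Mathlib

open MeasureTheory Metric
open scoped FourierTransform NNReal ENNReal

/-- The kernel of the fractional heat semigroup `e^{-t(-Δ)^α}` on `ℝⁿ`: the function whose Fourier
transform is the symbol `e^{-t|ξ|^{2α}}`, where `-Δ` has the symbol `|ξ|²`. Mathlib's Fourier
transform uses the character `e^{2πi⟨x,ξ⟩}`, so that `-Δ` has the symbol `(2π‖ξ‖)²` there.
The symbol is even and real, so the inverse transform is real. -/
noncomputable def fracHeatKernel {n : ℕ} (α t : ℝ) (x : EuclideanSpace ℝ (Fin n)) : ℝ :=
  (𝓕⁻ (fun ξ : EuclideanSpace ℝ (Fin n) =>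
    ((Real.exp (-(t * (2 * Real.pi * ‖ξ‖) ^ (2 * α))) : ℝ) : ℂ)) x).re

/-- The fractional heat semigroup `e^{-t(-Δ)^α} f (x) = ∫ e^{-t(-Δ)^α}(x - y) f(y) dy`. -/
noncomputable def fracHeat {n : ℕ} {𝕜 : Type*} [RCLike 𝕜] (α t : ℝ)
    (f : EuclideanSpace ℝ (Fin n) → 𝕜) (x : EuclideanSpace ℝ (Fin n)) : 𝕜 :=
  ∫ y, fracHeatKernel α t (x - y) • f y

/-- The partial sum
`T_N f = ∑_{j=N₁}^{N₂} v_j (e^{-a_{j+1}(-Δ)^α} f - e^{-a_j(-Δ)^α} f)`, with `N = (N₁, N₂)`. -/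
noncomputable def diffTransform {n : ℕ} {𝕜 : Type*} [RCLike 𝕜] (α : ℝ) (a v : ℤ → ℝ)
    (N₁ N₂ : ℤ) (f : EuclideanSpace ℝ (Fin n) → 𝕜) (x : EuclideanSpace ℝ (Fin n)) : 𝕜 :=
  ∑ j ∈ Finset.Icc N₁ N₂, v j • (fracHeat α (a (j + 1)) f x - fracHeat α (a j) f x)

/-- The truncated maximal operator `T_M^* f (x) = sup_{-M ≤ N₁ < N₂ ≤ M} |T_N f (x)|`. -/
noncomputable def maxDiffTransform {n : ℕ} {𝕜 : Type*} [RCLike 𝕜] (α : ℝ) (a v : ℤ → ℝ)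
    (M : ℤ) (f : EuclideanSpace ℝ (Fin n) → 𝕜) (x : EuclideanSpace ℝ (Fin n)) : ℝ≥0∞ :=
  ⨆ (N₁ : ℤ) (N₂ : ℤ) (_ : -M ≤ N₁) (_ : N₁ < N₂) (_ : N₂ ≤ M), ‖diffTransform α a v N₁ N₂ f x‖ₑ

/-- The (centred) Hardy–Littlewood maximal function
`sup_{r>0} |B(x,r)|⁻¹ ∫_{B(x,r)} |g(y)| dy`, with values in `[0, ∞]`. -/
noncomputable def maximalFn {n : ℕ} {𝕜 : Type*} [RCLike 𝕜]
    (g : EuclideanSpace ℝ (Fin n) → 𝕜) (x : EuclideanSpace ℝ (Fin n)) : ℝ≥0∞ :=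
  ⨆ (r : ℝ) (_ : 0 < r), (volume (ball x r))⁻¹ * ∫⁻ y in ball x r, ‖g y‖ₑ

/-- The maximal function
`sup_{r>0} (|B(x,r)|⁻¹ ∫_{B(x,r)} |g(y)|^q dy)^{1/q}`, with values in `[0, ∞]`. -/
noncomputable def maximalFnPow {n : ℕ} {𝕜 : Type*} [RCLike 𝕜] (q : ℝ)
    (g : EuclideanSpace ℝ (Fin n) → 𝕜) (x : EuclideanSpace ℝ (Fin n)) : ℝ≥0∞ :=
  ⨆ (r : ℝ) (_ : 0 < r), ((volume (ball x r))⁻¹ * ∫⁻ y in ball x r, ‖g y‖ₑ ^ q) ^ (1 / q)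

/-- A sequence of positive numbers indexed by `ℤ` is `lam`-lacunary if `a_{j+1} / a_j ≥ lam`
for all `j`. -/
def IsLacunary (lam : ℝ) (a : ℤ → ℝ) : Prop :=
  (∀ j, 0 < a j) ∧ ∀ j, lam ≤ a (j + 1) / a j

/-! Fix x, write H(t) for e^{-t(-Δ)^α}f(x), K_t for the kernel and 𝓜 for the Hardy–Littlewood
maximal function. The core is that smoothing T_{(-M,M)}f by the semigroup at time a_m nearly
discards the terms with j < m. By the semigroup law (`fracHeat_fracHeat`), the smoothed sum at x is
∑ v_j (H(a_m + a_{j+1}) - H(a_m + a_j)), and it is at most 𝓜(T_{(-M,M)}f)(x) because K_t is radially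
decreasing of mass at most 1. To compare it with the tail T_{(m,M)}f(x), use |H(t+s) - H(t)| ≤ C
(s/t) 𝓜f(x) for 0 ≤ s ≤ t (`exists_enorm_fracHeat_sub_le`). For j ≥ m the shift by a_m changes the
j-th term by O(a_m/a_j + a_m/a_{j+1}); for j < m the shifted term is itself O(a_{j+1}/a_m).
Lacunarity makes both families geometric (`norm_tail_sub_shift_le`). Hence every tail is at most
𝓜(T_{(-M,M)}f)(x) + C𝓜f(x), and T_{(N₁,N₂)} is the difference of the tails from N₁ and from N₂ + 1.
Finally 𝓜f ≤ 𝓜_q f. The time regularity comes from subordination: e^{-b|ξ|^{2α}} is a limit of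
mixtures of Gaussians in ξ, so K_t is a limit of mixtures of Gaussian densities. Monotonicity, the
mass bound and a dilation inequality hold for Gaussians and survive mixing and pointwise limits
(`IsRadialProfile`). With the scaling of K_t, the dilation inequality becomes |K_{t+s} - K_t| ≤ C
(s/t) K_{2^α(t+s)} (`exists_abs_fracHeatKernel_sub_le`). -/

/-! ### Laplace transforms of finite measures. -/

/-- `m` agrees on `[0, ∞)` with the Laplace transform of a finite measure on `[0, ∞)`. -/
def IsLaplaceTransform (m : ℝ → ℝ) : Prop :=
  ∃ μ : Measure ℝ, IsFiniteMeasure μ ∧ μ (Set.Iio 0) = 0 ∧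
    ∀ u, 0 ≤ u → m u = ∫ s, Real.exp (-(s * u)) ∂μ

theorem ae_nonneg_of_Iio {μ : Measure ℝ} (h : μ (Set.Iio 0) = 0) : ∀ᵐ s ∂μ, 0 ≤ s := by
  rw [ae_iff]
  simp only [not_le]
  exact h

theorem integrable_exp_neg_mul {μ : Measure ℝ} [IsFiniteMeasure μ] (h : μ (Set.Iio 0) = 0)
    {u : ℝ} (hu : 0 ≤ u) : Integrable (fun s => Real.exp (-(s * u))) μ := by
  refine (integrable_const (1 : ℝ)).mono' (by fun_prop) ?_
  filter_upwards [ae_nonneg_of_Iio h] with s hs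
  rw [Real.norm_eq_abs, Real.abs_exp, Real.exp_le_one_iff]
  nlinarith [mul_nonneg hs hu]

namespace IsLaplaceTransform

theorem one : IsLaplaceTransform (fun _ => 1) :=
  ⟨Measure.dirac 0, inferInstance, by simp, fun u _ => by simp⟩

theorem add {m₁ m₂ : ℝ → ℝ} (h₁ : IsLaplaceTransform m₁) (h₂ : IsLaplaceTransform m₂) :
    IsLaplaceTransform (fun u => m₁ u + m₂ u) := by
  obtain ⟨μ, _, hμ, h⟩ := h₁
  obtain ⟨ν, _, hν, h'⟩ := h₂
  refine ⟨μ + ν, inferInstance, by simp [hμ, hν], fun u hu => ?_⟩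
  beta_reduce
  rw [integral_add_measure (integrable_exp_neg_mul hμ hu) (integrable_exp_neg_mul hν hu),
    h u hu, h' u hu]

theorem const_mul {m : ℝ → ℝ} (h : IsLaplaceTransform m) {c : ℝ} (hc : 0 ≤ c) :
    IsLaplaceTransform (fun u => c * m u) := by
  obtain ⟨μ, _, hμ, h⟩ := h
  refine ⟨ENNReal.ofReal c • μ, μ.smul_finite ENNReal.ofReal_ne_top, by simp [hμ],
    fun u hu => ?_⟩
  beta_reduce
  rw [integral_smul_measure, h u hu, ENNReal.toReal_ofReal hc, smul_eq_mul]

/-- The representing measure is the convolution, that is, the image of the product measure under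
addition. -/
theorem mul {m₁ m₂ : ℝ → ℝ} (h₁ : IsLaplaceTransform m₁) (h₂ : IsLaplaceTransform m₂) :
    IsLaplaceTransform (fun u => m₁ u * m₂ u) := by
  obtain ⟨μ, _, hμ, h⟩ := h₁
  obtain ⟨ν, _, hν, h'⟩ := h₂
  refine ⟨(μ.prod ν).map (fun p => p.1 + p.2), inferInstance, ?_, fun u hu => ?_⟩
  · rw [Measure.map_apply (by fun_prop) measurableSet_Iio]
    refine measure_mono_null (t := (Set.Iio 0 ×ˢ Set.univ) ∪ (Set.univ ×ˢ Set.Iio 0)) ?_ ?_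
    · rintro ⟨a, b⟩ hab
      simp only [Set.mem_preimage, Set.mem_Iio] at hab
      by_cases ha : a < 0
      · exact Or.inl ⟨ha, trivial⟩
      · exact Or.inr ⟨trivial, by simp only [Set.mem_Iio]; linarith⟩
    · rw [measure_union_null_iff, Measure.prod_prod, Measure.prod_prod]
      simp [hμ, hν]
  · beta_reduce
    rw [integral_map (by fun_prop) (by fun_prop), h u hu, h' u hu, ← integral_prod_mul]
    refine integral_congr_ae (.of_forall fun p => ?_)
    simp only
    rw [← Real.exp_add]
    ring_nf

theorem pow {m : ℝ → ℝ} (h : IsLaplaceTransform m) (k : ℕ) :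
    IsLaplaceTransform (fun u => m u ^ k) := by
  induction k with
  | zero => simpa using one
  | succ k ih => simpa [pow_succ] using ih.mul h

theorem sum_range {m : ℕ → ℝ → ℝ} (h : ∀ k, IsLaplaceTransform (m k)) (N : ℕ) :
    IsLaplaceTransform (fun u => ∑ k ∈ Finset.range N, m k u) := by
  induction N with
  | zero => simpa using one.const_mul le_rfl
  | succ N ih => simpa [Finset.sum_range_succ] using ih.add (h N)

/-- The partial sums of `exp (m u - c)`. -/
theorem exp_partial_sum {m : ℝ → ℝ} (h : IsLaplaceTransform m) (c : ℝ) (N : ℕ) :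
    IsLaplaceTransform
      (fun u => Real.exp (-c) * ∑ k ∈ Finset.range N, (m u) ^ k / (k.factorial : ℝ)) := by
  refine const_mul (sum_range (fun k => ?_) N) (Real.exp_pos _).le
  simpa [div_eq_inv_mul] using (h.pow k).const_mul (c := (k.factorial : ℝ)⁻¹) (by positivity)

theorem nonneg {m : ℝ → ℝ} (h : IsLaplaceTransform m) {u : ℝ} (hu : 0 ≤ u) : 0 ≤ m u := by
  obtain ⟨μ, _, hμ, h⟩ := h
  rw [h u hu]
  exact integral_nonneg fun s => (Real.exp_pos _).le

theorem antitoneOn {m : ℝ → ℝ} (h : IsLaplaceTransform m) : AntitoneOn m (Set.Ici 0) := by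
  obtain ⟨μ, _, hμ, h⟩ := h
  intro u hu v hv huv
  rw [h u hu, h v hv]
  refine integral_mono_ae (integrable_exp_neg_mul hμ hv) (integrable_exp_neg_mul hμ hu) ?_
  filter_upwards [ae_nonneg_of_Iio hμ] with s hs
  gcongr

end IsLaplaceTransform

/-! ### The power u^α as a superposition of the functions 1 - e^{-su}. -/

/-- Near 0 the bound 1 - e^{-su} ≤ su leaves s^{-α}, integrable since α < 1; at infinity s^{-1-α}
suffices since α > 0. -/
theorem integrableOn_one_sub_exp_mul_rpow {α : ℝ} (hα₀ : 0 < α) (hα₁ : α < 1) {u : ℝ}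
    (hu : 0 ≤ u) :
    IntegrableOn (fun s : ℝ => (1 - Real.exp (-(s * u))) * s ^ (-1 - α)) (Set.Ioi 0) := by
  have hm : Measurable (fun s : ℝ => (1 - Real.exp (-(s * u))) * s ^ (-1 - α)) := by fun_prop
  rw [← Set.Ioc_union_Ioi_eq_Ioi zero_le_one]
  refine IntegrableOn.union ?_ ?_
  · have h1 : IntegrableOn (fun s : ℝ => u * s ^ (-α)) (Set.Ioc 0 1) := by
      have := intervalIntegral.intervalIntegrable_rpow' (a := 0) (b := 1) (r := -α) (by linarith)
      rw [intervalIntegrable_iff_integrableOn_Ioc_of_le zero_le_one] at this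
      exact this.const_mul u
    refine Integrable.mono' h1 hm.aestronglyMeasurable ?_
    filter_upwards [ae_restrict_mem measurableSet_Ioc] with s hs
    have hs0 : 0 < s := hs.1
    have hp : 0 < s ^ (-1 - α) := Real.rpow_pos_of_pos hs0 _
    have hle : Real.exp (-(s * u)) ≤ 1 := Real.exp_le_one_iff.2 (by nlinarith)
    have hge := Real.add_one_le_exp (-(s * u))
    rw [Real.norm_of_nonneg (mul_nonneg (by linarith) hp.le)]
    have : s ^ (-α) = s * s ^ (-1 - α) := by
      rw [← Real.rpow_one_add' hs0.le (by linarith)]; ring_nf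
    rw [this, ← mul_assoc]
    gcongr
    linarith
  · refine Integrable.mono' (integrableOn_Ioi_rpow_of_lt (a := -1 - α) (by linarith) one_pos)
      hm.aestronglyMeasurable ?_
    filter_upwards [ae_restrict_mem measurableSet_Ioi] with s hs
    have hs0 : 0 < s := one_pos.trans hs
    have hp : 0 < s ^ (-1 - α) := Real.rpow_pos_of_pos hs0 _
    have hle : Real.exp (-(s * u)) ≤ 1 := Real.exp_le_one_iff.2 (by nlinarith)
    rw [Real.norm_of_nonneg (mul_nonneg (by linarith) hp.le)]
    have := Real.exp_pos (-(s * u))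
    nlinarith

theorem integral_one_sub_exp_mul_rpow {α : ℝ} (hα₀ : 0 < α) {u : ℝ} (hu : 0 ≤ u) :
    ∫ s in Set.Ioi (0 : ℝ), (1 - Real.exp (-(s * u))) * s ^ (-1 - α) =
      u ^ α * ∫ s in Set.Ioi (0 : ℝ), (1 - Real.exp (-s)) * s ^ (-1 - α) := by
  rcases hu.eq_or_lt with rfl | hu
  · simp [Real.zero_rpow hα₀.ne']
  have h := integral_comp_mul_left_Ioi
    (fun s : ℝ => (1 - Real.exp (-s)) * s ^ (-1 - α)) 0 hu
  rw [mul_zero, smul_eq_mul] at h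
  have h2 : u ^ α * u ^ (-1 - α) = u⁻¹ := by
    rw [← Real.rpow_add hu, ← Real.rpow_neg_one]; ring_nf
  have h3 : ∫ s in Set.Ioi (0 : ℝ), (1 - Real.exp (-(u * s))) * (u * s) ^ (-1 - α) =
      u ^ (-1 - α) * ∫ s in Set.Ioi (0 : ℝ), (1 - Real.exp (-(s * u))) * s ^ (-1 - α) := by
    rw [← integral_const_mul]
    refine setIntegral_congr_fun measurableSet_Ioi fun s hs => ?_
    rw [Real.mul_rpow hu.le (le_of_lt hs), mul_comm u s]
    ring
  rw [h3] at h
  have hp : 0 < u ^ (-1 - α) := Real.rpow_pos_of_pos hu _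
  have hI := h
  rw [← h2, mul_comm (u ^ α), mul_assoc] at hI
  exact mul_left_cancel₀ hp.ne' hI

theorem integral_one_sub_exp_mul_rpow_pos {α : ℝ} (hα₀ : 0 < α) (hα₁ : α < 1) :
    0 < ∫ s in Set.Ioi (0 : ℝ), (1 - Real.exp (-s)) * s ^ (-1 - α) := by
  have hpos : ∀ s ∈ Set.Ioi (0 : ℝ), 0 < (1 - Real.exp (-s)) * s ^ (-1 - α) := fun s hs =>
    mul_pos (sub_pos.2 (Real.exp_lt_one_iff.2 (neg_lt_zero.2 hs))) (Real.rpow_pos_of_pos hs _)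
  rw [setIntegral_pos_iff_support_of_nonneg_ae]
  · refine lt_of_lt_of_le ?_ (measure_mono (s := Set.Ioi (0 : ℝ)) fun s hs => ⟨(hpos s hs).ne', hs⟩)
    simp
  · filter_upwards [ae_restrict_mem measurableSet_Ioi] with s hs using (hpos s hs).le
  · simpa using integrableOn_one_sub_exp_mul_rpow hα₀ hα₁ zero_le_one

/-- The power `b * u ^ α` is a limit of differences `m 0 - m u` with `m` a Laplace transform. -/
theorem exists_laplaceTransform_tendsto_rpow {α : ℝ} (hα₀ : 0 < α) (hα₁ : α < 1) {b : ℝ}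
    (hb : 0 ≤ b) :
    ∃ m : ℕ → ℝ → ℝ, (∀ N, IsLaplaceTransform (m N)) ∧
      ∀ u, 0 ≤ u → Filter.Tendsto (fun N => m N 0 - m N u) Filter.atTop (nhds (b * u ^ α)) := by
  set I := ∫ s in Set.Ioi (0 : ℝ), (1 - Real.exp (-s)) * s ^ (-1 - α) with hI
  have hIpos : 0 < I := integral_one_sub_exp_mul_rpow_pos hα₀ hα₁
  have hw (N : ℕ) : IntegrableOn (fun s : ℝ => s ^ (-1 - α)) (Set.Ioi (1 / ((N : ℝ) + 1))) :=
    integrableOn_Ioi_rpow_of_lt (by linarith) (by positivity)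
  have hwpos (N : ℕ) : ∀ s ∈ Set.Ioi (1 / ((N : ℝ) + 1)), 0 < s := fun s hs =>
    lt_trans (by positivity) hs
  have hwe (N : ℕ) {u : ℝ} (hu : 0 ≤ u) : IntegrableOn
      (fun s : ℝ => Real.exp (-(s * u)) * s ^ (-1 - α)) (Set.Ioi (1 / ((N : ℝ) + 1))) := by
    refine Integrable.mono' (hw N) (by fun_prop) ?_
    filter_upwards [ae_restrict_mem measurableSet_Ioi] with s hs
    have hs0 := hwpos N s hs
    have hp : 0 < s ^ (-1 - α) := Real.rpow_pos_of_pos hs0 _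
    have hle : Real.exp (-(s * u)) ≤ 1 := Real.exp_le_one_iff.2 (by nlinarith)
    rw [Real.norm_of_nonneg (by positivity)]
    nlinarith
  -- The density s^{-1-α} has infinite mass at 0, so it is cut off at 1/(N+1); the differences need
  -- no cut-off in the limit. Dividing by `I` normalises the limit to b u^α.
  refine ⟨fun N u => (b / I) * ∫ s in Set.Ioi (1 / ((N : ℝ) + 1)),
    Real.exp (-(s * u)) * s ^ (-1 - α), fun N => ?_, fun u hu => ?_⟩
  · refine IsLaplaceTransform.const_mul ?_ (by positivity)
    refine ⟨(volume.restrict (Set.Ioi (1 / ((N : ℝ) + 1)))).withDensity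
      (fun s => ENNReal.ofReal (s ^ (-1 - α))), ?_, ?_, fun u hu => ?_⟩
    · refine isFiniteMeasure_withDensity_ofReal ?_
      exact (hw N).2
    · rw [withDensity_apply _ measurableSet_Iio, Measure.restrict_restrict measurableSet_Iio]
      have : Set.Iio (0 : ℝ) ∩ Set.Ioi (1 / ((N : ℝ) + 1)) = ∅ := by
        ext s
        simp only [Set.mem_inter_iff, Set.mem_Iio, Set.mem_empty_iff_false, iff_false, not_and]
        intro h1 h2
        exact absurd (hwpos N s h2) (by linarith)
      rw [this, Measure.restrict_empty, lintegral_zero_measure]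
    · rw [integral_withDensity_eq_integral_toReal_smul (by fun_prop) (by simp)]
      refine setIntegral_congr_fun measurableSet_Ioi fun s hs => ?_
      have hp : 0 < s ^ (-1 - α) := Real.rpow_pos_of_pos (hwpos N s hs) _
      simp only [smul_eq_mul]
      rw [ENNReal.toReal_ofReal hp.le, mul_comm]
  · have hlim := tendsto_setIntegral_of_monotone (μ := volume)
      (s := fun N : ℕ => Set.Ioi (1 / ((N : ℝ) + 1)))
      (f := fun s : ℝ => (1 - Real.exp (-(s * u))) * s ^ (-1 - α))
      (fun _ => measurableSet_Ioi) ?_ ?_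
    · have hU : (⋃ N : ℕ, Set.Ioi (1 / ((N : ℝ) + 1))) = Set.Ioi (0 : ℝ) := by
        ext s
        simp only [Set.mem_iUnion]
        exact ⟨fun ⟨N, h⟩ => hwpos N s h, fun h => exists_nat_one_div_lt (Set.mem_Ioi.1 h)⟩
      rw [hU, integral_one_sub_exp_mul_rpow hα₀ hu] at hlim
      have := hlim.const_mul (b / I)
      rw [← hI, show b / I * (u ^ α * I) = b * u ^ α by field_simp] at this
      refine this.congr fun N => ?_
      rw [← mul_sub, ← integral_sub (hwe N le_rfl) (hwe N hu)]
      congr 1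
      refine integral_congr_ae (.of_forall fun s => ?_)
      simp [sub_mul]
    · intro N N' h
      refine Set.Ioi_subset_Ioi ?_
      gcongr
    · refine (integrableOn_one_sub_exp_mul_rpow hα₀ hα₁ hu).mono_set ?_
      exact Set.iUnion_subset fun N => hwpos N

theorem IsLaplaceTransform.measurable_comp_norm_sq {V : Type*} [NormedAddCommGroup V]
    [MeasurableSpace V] [BorelSpace V] {m : ℝ → ℝ} (h : IsLaplaceTransform m) :
    Measurable (fun ξ : V => m (‖ξ‖ ^ 2)) := by
  have h1 : Antitone (fun u : ℝ => m (max u 0)) := fun u v huv =>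
    h.antitoneOn (Set.mem_Ici.2 (le_max_right _ _)) (Set.mem_Ici.2 (le_max_right _ _))
      (max_le_max_right 0 huv)
  have h2 : Measurable (fun ξ : V => ‖ξ‖ ^ 2) := by fun_prop
  have h3 := h1.measurable.comp h2
  simpa [Function.comp_def] using h3

/-! ### Gaussian mixtures and their limits. -/

section RadialProfile

variable {V : Type*} [NormedAddCommGroup V] [InnerProductSpace ℝ V] [FiniteDimensional ℝ V]
  [MeasurableSpace V] [BorelSpace V]

/-- Properties shared by all mixtures of centred Gaussian densities of total mass at most one and
stable under pointwise limits. -/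
structure IsRadialProfile (k : V → ℂ) : Prop where
  measurable : Measurable k
  im_eq_zero : ∀ x, (k x).im = 0
  nonneg : ∀ x, 0 ≤ (k x).re
  anti : ∀ x y, ‖x‖ ≤ ‖y‖ → (k y).re ≤ (k x).re
  -- Difference form of a radial derivative bound. Being linear in `k` and non-strict, it passes to
  -- positive mixtures and pointwise limits.
  dilate : ∀ ρ : ℝ, 0 < ρ → ρ ≤ 1 → ∀ x,
    (k (ρ • x)).re - (k x).re ≤ ((ρ ^ 2)⁻¹ - 1) * (k ((ρ / √2) • x)).re
  -- An inequality, because Fatou's lemma preserves only this direction in the limit.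
  lintegral_le : ∫⁻ x, ENNReal.ofReal (k x).re ≤ 1

theorem IsRadialProfile.of_tendsto {k : ℕ → V → ℂ} {k' : V → ℂ} (h : ∀ N, IsRadialProfile (k N))
    (hlim : ∀ x, Filter.Tendsto (fun N => k N x) Filter.atTop (nhds (k' x))) :
    IsRadialProfile k' := by
  have hre (x : V) : Filter.Tendsto (fun N => (k N x).re) Filter.atTop (nhds (k' x).re) :=
    (Complex.continuous_re.tendsto _).comp (hlim x)
  have him (x : V) : Filter.Tendsto (fun N => (k N x).im) Filter.atTop (nhds (k' x).im) :=
    (Complex.continuous_im.tendsto _).comp (hlim x)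
  refine ⟨measurable_of_tendsto_metrizable (fun N => (h N).measurable) (tendsto_pi_nhds.2 hlim),
    fun x => ?_, fun x => ?_, fun x y hxy => ?_, fun ρ h₀ h₁ x => ?_, ?_⟩
  · exact tendsto_nhds_unique (him x) (by simp [(h _).im_eq_zero])
  · exact ge_of_tendsto' (hre x) fun N => (h N).nonneg x
  · exact le_of_tendsto_of_tendsto' (hre y) (hre x) fun N => (h N).anti x y hxy
  · exact le_of_tendsto_of_tendsto' ((hre _).sub (hre x)) ((hre _).const_mul _)
      fun N => (h N).dilate ρ h₀ h₁ x
  · have hl (x : V) : ENNReal.ofReal (k' x).re =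
        Filter.liminf (fun N => ENNReal.ofReal (k N x).re) Filter.atTop :=
      ((ENNReal.continuous_ofReal.tendsto _).comp (hre x)).liminf_eq.symm
    simp_rw [hl]
    refine (lintegral_liminf_le fun N =>
      (Complex.measurable_re.comp (h N).measurable).ennreal_ofReal).trans ?_
    exact Filter.liminf_le_of_le (by isBoundedDefault) fun b hb => by
      obtain ⟨N, hN⟩ := hb.exists
      exact hN.trans (h N).lintegral_le

theorem integrable_exp_neg_mul_norm_rpow [Nontrivial V] {b p : ℝ} (hb : 0 < b) (hp : 0 < p) :
    Integrable (fun ξ : V => Real.exp (-(b * ‖ξ‖ ^ p))) := by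
  rw [integrable_fun_norm_addHaar (E := V) volume (f := fun y : ℝ => Real.exp (-(b * y ^ p)))]
  refine (integrableOn_rpow_mul_exp_neg_mul_rpow (p := p) (b := b)
    (s := ((Module.finrank ℝ V - 1 : ℕ) : ℝ)) ?_ hp hb).congr_fun ?_ measurableSet_Ioi
  · exact lt_of_lt_of_le (by norm_num) (Nat.cast_nonneg _)
  · intro y hy
    simp [Real.rpow_natCast]

theorem integrable_exp_neg_mul_norm_sq [Nontrivial V] {b : ℝ} (hb : 0 < b) :
    Integrable (fun ξ : V => Real.exp (-(b * ‖ξ‖ ^ 2))) := by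
  simpa using integrable_exp_neg_mul_norm_rpow (V := V) hb two_pos

theorem fourierInv_gaussian [Nontrivial V] {b : ℝ} (hb : 0 < b) (x : V) :
    𝓕⁻ (fun ξ : V => ((Real.exp (-(b * ‖ξ‖ ^ 2)) : ℝ) : ℂ)) x =
      (((Real.pi / b) ^ (Module.finrank ℝ V / 2 : ℝ) *
        Real.exp (-(Real.pi ^ 2 / b * ‖x‖ ^ 2)) : ℝ) : ℂ) := by
  have h := fourier_gaussian_innerProductSpace (b := (b : ℂ)) (by simpa using hb) (-x)
  rw [Real.fourierInv_eq_fourier_neg]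
  convert h using 2
  · ext v
    push_cast
    ring_nf
  · push_cast
    rw [Complex.ofReal_cpow (by positivity)]
    push_cast
    rw [norm_neg]
    ring_nf

/-- With y = Aρ²/2, the bound 1 - e^{-z} ≤ z gives at most e^{-2y} A(1 - ρ²). One factor e^{-y}
absorbs the growth of A through 2y e^{-y} ≤ 1; the other remains, which is the source of ρ/√2 in
`IsRadialProfile.dilate`. -/
theorem exp_dilate_sub_le {A ρ : ℝ} (hA : 0 ≤ A) (h₀ : 0 < ρ) (h₁ : ρ ≤ 1) :
    Real.exp (-(A * ρ ^ 2)) - Real.exp (-A) ≤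
      ((ρ ^ 2)⁻¹ - 1) * Real.exp (-(A * (ρ ^ 2 / 2))) := by
  set y := A * (ρ ^ 2 / 2) with hy
  have hy0 : 0 ≤ y := by positivity
  have hρ : 0 < ρ ^ 2 := by positivity
  have hρ1 : ρ ^ 2 ≤ 1 := pow_le_one₀ h₀.le h₁
  have e1 : Real.exp (-(A * ρ ^ 2)) = Real.exp (-y) * Real.exp (-y) := by
    rw [← Real.exp_add]
    congr 1
    rw [hy]; ring
  have e2 : Real.exp (-A) = Real.exp (-(A * ρ ^ 2)) * Real.exp (-(A * (1 - ρ ^ 2))) := by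
    rw [← Real.exp_add]; ring_nf
  have e3 : 1 - A * (1 - ρ ^ 2) ≤ Real.exp (-(A * (1 - ρ ^ 2))) := by
    have := Real.add_one_le_exp (-(A * (1 - ρ ^ 2)))
    linarith
  have e4 : 2 * y * Real.exp (-y) ≤ 1 := by
    have h1 : 2 * y ≤ Real.exp y := by
      have h2 := Real.add_one_le_exp (y / 2)
      have h3 : Real.exp y = Real.exp (y / 2) ^ 2 := by rw [← Real.exp_nat_mul]; ring_nf
      rw [h3]
      nlinarith [sq_nonneg (y / 2 - 1)]
    calc 2 * y * Real.exp (-y) ≤ Real.exp y * Real.exp (-y) := by gcongr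
      _ = 1 := by rw [← Real.exp_add]; simp
  have hA' : A = (ρ ^ 2)⁻¹ * (2 * y) := by rw [hy]; field_simp
  have hE := Real.exp_pos (-y)
  calc Real.exp (-(A * ρ ^ 2)) - Real.exp (-A)
      ≤ Real.exp (-(A * ρ ^ 2)) * (A * (1 - ρ ^ 2)) := by
        rw [e2]
        nlinarith [Real.exp_pos (-(A * ρ ^ 2))]
    _ = (ρ ^ 2)⁻¹ * (1 - ρ ^ 2) * Real.exp (-y) * (2 * y * Real.exp (-y)) := by
        rw [e1]
        nth_rewrite 1 [hA']
        ring
    _ ≤ (ρ ^ 2)⁻¹ * (1 - ρ ^ 2) * Real.exp (-y) * 1 := by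
        have : 0 ≤ 1 - ρ ^ 2 := by linarith
        gcongr
    _ = ((ρ ^ 2)⁻¹ - 1) * Real.exp (-y) := by field_simp

/-- Mixtures of centred Gaussian densities. -/
theorem IsRadialProfile.gaussian_mixture [Nontrivial V] {μ : Measure ℝ} [IsFiniteMeasure μ]
    (hμ : μ (Set.Iio 0) = 0) (hμ1 : μ Set.univ ≤ 1) {δ : ℝ} (hδ : 0 < δ) :
    IsRadialProfile (fun x : V => ((∫ s, (Real.pi / (s + δ)) ^ (Module.finrank ℝ V / 2 : ℝ) *
        Real.exp (-(Real.pi ^ 2 / (s + δ) * ‖x‖ ^ 2)) ∂μ : ℝ) : ℂ)) := by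
  set d : ℝ := Module.finrank ℝ V / 2 with hd
  have hd0 : 0 ≤ d := by positivity
  have hs0 := ae_nonneg_of_Iio hμ
  set g : V → ℝ → ℝ := fun x s => (Real.pi / (s + δ)) ^ d *
        Real.exp (-(Real.pi ^ 2 / (s + δ) * ‖x‖ ^ 2)) with hg
  have hgm : Measurable (Function.uncurry g) := by
    simp only [hg, Function.uncurry_def]
    fun_prop
  have hgnn (x : V) : 0 ≤ᵐ[μ] g x := by
    filter_upwards [hs0] with s hs
    simp only [hg, Pi.zero_apply]
    positivity
  have hgi (x : V) : Integrable (g x) μ := by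
    refine (integrable_const ((Real.pi / δ) ^ d)).mono'
      (hgm.comp measurable_prodMk_left).aestronglyMeasurable ?_
    filter_upwards [hs0] with s hs
    have h1 : 0 ≤ (Real.pi / (s + δ)) ^ d := by positivity
    rw [Real.norm_of_nonneg (by simp only [hg]; positivity)]
    calc g x s ≤ (Real.pi / (s + δ)) ^ d * 1 := by
          simp only [hg]
          gcongr
          rw [Real.exp_le_one_iff]
          have : 0 ≤ Real.pi ^ 2 / (s + δ) * ‖x‖ ^ 2 := by positivity
          linarith
      _ ≤ (Real.pi / δ) ^ d := by
          rw [mul_one]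
          gcongr
          linarith
  refine ⟨?_, fun x => by simp, fun x => ?_, fun x y hxy => ?_, fun ρ h₀ h₁ x => ?_, ?_⟩
  · exact Complex.measurable_ofReal.comp
      (hgm.stronglyMeasurable.integral_prod_right (ν := μ)).measurable
  · simpa using integral_nonneg_of_ae (hgnn x)
  · simp only [Complex.ofReal_re]
    refine integral_mono_ae (hgi y) (hgi x) ?_
    filter_upwards [hs0] with s hs
    gcongr
  · simp only [Complex.ofReal_re]
    rw [← integral_sub (hgi _) (hgi x), ← integral_const_mul]
    refine integral_mono_ae ((hgi _).sub (hgi x)) ((hgi _).const_mul _) ?_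
    filter_upwards [hs0] with s hs
    have hA : 0 ≤ Real.pi ^ 2 / (s + δ) * ‖x‖ ^ 2 := by positivity
    have h1 : 0 ≤ (Real.pi / (s + δ)) ^ d := by positivity
    have hn1 : ‖ρ • x‖ ^ 2 = ρ ^ 2 * ‖x‖ ^ 2 := by
      rw [norm_smul, mul_pow, Real.norm_eq_abs, sq_abs]
    have hn2 : ‖(ρ / √2) • x‖ ^ 2 = ρ ^ 2 / 2 * ‖x‖ ^ 2 := by
      rw [norm_smul, mul_pow, Real.norm_eq_abs, sq_abs, div_pow, Real.sq_sqrt zero_le_two]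
    have key := mul_le_mul_of_nonneg_left (exp_dilate_sub_le hA h₀ h₁) h1
    simp only [hg, hn1, hn2]
    calc _ = _ := by ring_nf
      _ ≤ _ := key
      _ = _ := by ring_nf
  · simp only [Complex.ofReal_re]
    have h1 (x : V) : ENNReal.ofReal (∫ s, g x s ∂μ) = ∫⁻ s, ENNReal.ofReal (g x s) ∂μ :=
      ofReal_integral_eq_lintegral_ofReal (hgi x) (hgnn x)
    change ∫⁻ x : V, ENNReal.ofReal (∫ s, g x s ∂μ) ≤ 1
    rw [lintegral_congr h1, lintegral_lintegral_swap hgm.ennreal_ofReal.aemeasurable]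
    calc ∫⁻ s, (∫⁻ x, ENNReal.ofReal (g x s)) ∂μ = ∫⁻ _, 1 ∂μ := by
          refine lintegral_congr_ae ?_
          filter_upwards [hs0] with s hs
          have hb : 0 < Real.pi ^ 2 / (s + δ) := by positivity
          have hi : Integrable (fun x : V => g x s) := by
            simp only [hg]
            exact (integrable_exp_neg_mul_norm_sq hb).const_mul _
          rw [← ofReal_integral_eq_lintegral_ofReal hi
            (.of_forall fun x => by simp only [hg, Pi.zero_apply]; positivity)]
          simp only [hg]
          rw [integral_const_mul]
          have := GaussianFourier.integral_rexp_neg_mul_sq_norm (V := V) hb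
          simp only [neg_mul] at this
          rw [this, ← hd, ← Real.mul_rpow (by positivity) (by positivity)]
          have : Real.pi / (s + δ) * (Real.pi / (Real.pi ^ 2 / (s + δ))) = 1 := by
            have : s + δ ≠ 0 := by positivity
            field_simp
          rw [this, Real.one_rpow, ENNReal.ofReal_one]
      _ ≤ 1 := by simpa using hμ1

/-- By Fubini, the inverse transform acts on each e^{-(s+δ)|ξ|²} separately. The factor with δ
provides integrability in ξ uniformly in s ≥ 0. -/
theorem IsLaplaceTransform.isRadialProfile_fourierInv [Nontrivial V] {m : ℝ → ℝ}
    (h : IsLaplaceTransform m) (h0 : m 0 ≤ 1) {δ : ℝ} (hδ : 0 < δ) :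
    IsRadialProfile
      (𝓕⁻ (fun ξ : V => ((Real.exp (-(δ * ‖ξ‖ ^ 2)) * m (‖ξ‖ ^ 2) : ℝ) : ℂ))) := by
  obtain ⟨μ, _, hμ, h⟩ := h
  have hμ1 : μ Set.univ ≤ 1 := by
    have := h 0 le_rfl
    simp only [mul_zero, neg_zero, Real.exp_zero, integral_const, smul_eq_mul, mul_one] at this
    rw [this] at h0
    rw [← ENNReal.ofReal_toReal (measure_ne_top μ Set.univ)]
    exact ENNReal.ofReal_le_one.2 h0
  have hs0 := ae_nonneg_of_Iio hμ
  convert IsRadialProfile.gaussian_mixture (V := V) hμ hμ1 hδ using 1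
  ext x
  rw [Real.fourierInv_eq]
  have h1 (ξ : V) : ((Real.exp (-(δ * ‖ξ‖ ^ 2)) * m (‖ξ‖ ^ 2) : ℝ) : ℂ) =
      ∫ s, ((Real.exp (-((s + δ) * ‖ξ‖ ^ 2)) : ℝ) : ℂ) ∂μ := by
    rw [integral_complex_ofReal, h _ (by positivity), ← integral_const_mul]
    congr 1
    refine integral_congr_ae (.of_forall fun s => ?_)
    simp only
    rw [← Real.exp_add]
    ring_nf
  simp_rw [h1, Circle.smul_def, ← integral_smul]
  rw [integral_integral_swap, ← integral_complex_ofReal]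
  · refine integral_congr_ae ?_
    filter_upwards [hs0] with s hs
    rw [← fourierInv_gaussian (by linarith), Real.fourierInv_eq]
    rfl
  · have hb : Integrable (fun p : V × ℝ => Real.exp (-(δ * ‖p.1‖ ^ 2)) * (1 : ℝ))
        (volume.prod μ) :=
      (integrable_exp_neg_mul_norm_sq hδ).mul_prod (integrable_const (1 : ℝ))
    refine hb.mono' ?_ ?_
    · refine Continuous.aestronglyMeasurable ?_
      simp only [Function.uncurry_def]
      fun_prop
    · have : ∀ᵐ p : V × ℝ ∂(volume.prod μ), 0 ≤ p.2 :=
        Measure.quasiMeasurePreserving_snd.ae hs0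
      filter_upwards [this] with p hp
      simp only [Function.uncurry_def, norm_smul, Circle.norm_coe, one_mul, mul_one,
        Complex.norm_real, Real.norm_eq_abs, Real.abs_exp]
      gcongr
      linarith

theorem tendsto_fourierInv_of_dominated {F : ℕ → V → ℝ} {G B : V → ℝ}
    (hF : ∀ N, Measurable (F N)) (hB : Integrable B) (hle : ∀ N ξ, |F N ξ| ≤ B ξ)
    (hlim : ∀ ξ, Filter.Tendsto (fun N => F N ξ) Filter.atTop (nhds (G ξ))) (x : V) :
    Filter.Tendsto (fun N => 𝓕⁻ (fun ξ => (F N ξ : ℂ)) x) Filter.atTop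
      (nhds (𝓕⁻ (fun ξ => (G ξ : ℂ)) x)) := by
  simp only [Real.fourierInv_eq, Circle.smul_def]
  refine tendsto_integral_of_dominated_convergence B (fun N => ?_) hB (fun N => ?_) ?_
  · have h1 : Measurable (fun ξ : V => ((Real.fourierChar (inner ℝ ξ x) : Circle) : ℂ)) :=
      Continuous.measurable (by fun_prop)
    exact (h1.smul (Complex.measurable_ofReal.comp (hF N))).aestronglyMeasurable
  · refine .of_forall fun ξ => ?_
    simpa only [norm_smul, Circle.norm_coe, one_mul, Complex.norm_real, Real.norm_eq_abs]
      using hle N ξ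
  · exact .of_forall fun ξ =>
      ((Complex.continuous_ofReal.tendsto _).comp (hlim ξ)).const_smul _

/-- The partial sums of the exponential series are Laplace transforms with value at most 1 at 0;
dominated convergence passes to the limit. -/
theorem IsLaplaceTransform.isRadialProfile_fourierInv_exp [Nontrivial V] {m : ℝ → ℝ}
    (h : IsLaplaceTransform m) {δ : ℝ} (hδ : 0 < δ) :
    IsRadialProfile (𝓕⁻ (fun ξ : V =>
      ((Real.exp (-(δ * ‖ξ‖ ^ 2)) * Real.exp (m (‖ξ‖ ^ 2) - m 0) : ℝ) : ℂ))) := by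
  have hS (N : ℕ) := h.exp_partial_sum (m 0) N
  have hSle (N : ℕ) {u : ℝ} (hu : 0 ≤ u) :
      Real.exp (-m 0) * ∑ k ∈ Finset.range N, (m u) ^ k / (k.factorial : ℝ) ≤ 1 := by
    calc _ ≤ Real.exp (-m 0) * Real.exp (m u) := by
          gcongr
          exact Real.sum_le_exp_of_nonneg (h.nonneg hu) N
      _ ≤ 1 := by
          rw [← Real.exp_add, Real.exp_le_one_iff]
          linarith [h.antitoneOn (Set.mem_Ici.2 le_rfl) (Set.mem_Ici.2 hu) hu]
  refine IsRadialProfile.of_tendsto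
    (fun N => (hS N).isRadialProfile_fourierInv (hSle N le_rfl) hδ)
    (tendsto_fourierInv_of_dominated (B := fun ξ => Real.exp (-(δ * ‖ξ‖ ^ 2))) (fun N => ?_)
      (integrable_exp_neg_mul_norm_sq hδ) (fun N ξ => ?_) fun ξ => ?_)
  · exact Measurable.mul (by fun_prop) (hS N).measurable_comp_norm_sq
  · rw [abs_of_nonneg (mul_nonneg (Real.exp_pos _).le ((hS N).nonneg (by positivity)))]
    exact mul_le_of_le_one_right (Real.exp_pos _).le (hSle N (by positivity))
  · refine Filter.Tendsto.const_mul _ ?_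
    have := (NormedSpace.expSeries_div_hasSum_exp (m (‖ξ‖ ^ 2))).tendsto_sum_nat
    rw [← Real.exp_eq_exp_ℝ] at this
    rw [sub_eq_neg_add, Real.exp_add]
    exact this.const_mul _

/-- Two limits: N → ∞ at fixed δ, where the Gaussian factor dominates since exp(m(u) - m(0)) need
not decay, then δ → 0, where the limiting symbol dominates. -/
theorem isRadialProfile_fourierInv_exp_neg_rpow [Nontrivial V] {α : ℝ} (hα₀ : 0 < α) (hα₁ : α < 1)
    {b : ℝ} (hb : 0 < b) :
    IsRadialProfile (𝓕⁻ (fun ξ : V => ((Real.exp (-(b * ‖ξ‖ ^ (2 * α))) : ℝ) : ℂ))) := by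
  obtain ⟨m, hm, hlim⟩ := exists_laplaceTransform_tendsto_rpow hα₀ hα₁ hb.le
  have hpow (ξ : V) : (‖ξ‖ ^ 2) ^ α = ‖ξ‖ ^ (2 * α) := by
    rw [Real.rpow_mul (norm_nonneg _), Real.rpow_two]
  have hδ {δ : ℝ} (hδ : 0 < δ) : IsRadialProfile (𝓕⁻ (fun ξ : V =>
      ((Real.exp (-(δ * ‖ξ‖ ^ 2)) * Real.exp (-(b * ‖ξ‖ ^ (2 * α))) : ℝ) : ℂ))) := by
    refine IsRadialProfile.of_tendsto (fun N => (hm N).isRadialProfile_fourierInv_exp hδ)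
      (tendsto_fourierInv_of_dominated (B := fun ξ => Real.exp (-(δ * ‖ξ‖ ^ 2))) (fun N => ?_)
      (integrable_exp_neg_mul_norm_sq hδ) (fun N ξ => ?_) fun ξ => ?_)
    · exact Measurable.mul (by fun_prop)
        (Real.measurable_exp.comp ((hm N).measurable_comp_norm_sq.sub_const _))
    · rw [abs_of_nonneg (by positivity)]
      refine mul_le_of_le_one_right (Real.exp_pos _).le ?_
      rw [Real.exp_le_one_iff]
      have h0 : 0 ≤ ‖ξ‖ ^ 2 := by positivity
      linarith [(hm N).antitoneOn (Set.mem_Ici.2 le_rfl) (Set.mem_Ici.2 h0) h0]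
    · refine Filter.Tendsto.const_mul _ ?_
      refine (Real.continuous_exp.tendsto _).comp ?_
      have := (hlim (‖ξ‖ ^ 2) (by positivity)).neg
      rw [hpow] at this
      simpa using this
  refine IsRadialProfile.of_tendsto (fun N : ℕ => hδ (δ := 1 / ((N : ℝ) + 1)) (by positivity))
      (tendsto_fourierInv_of_dominated (B := fun ξ => Real.exp (-(b * ‖ξ‖ ^ (2 * α)))) (fun N => ?_)
      (integrable_exp_neg_mul_norm_rpow hb (by positivity)) (fun N ξ => ?_) fun ξ => ?_)
  · fun_prop
  · rw [abs_of_nonneg (by positivity)]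
    refine mul_le_of_le_one_left (Real.exp_pos _).le ?_
    rw [Real.exp_le_one_iff]
    have : 0 ≤ 1 / ((N : ℝ) + 1) * ‖ξ‖ ^ 2 := by positivity
    linarith
  · have h1 : Filter.Tendsto (fun N : ℕ => -(1 / ((N : ℝ) + 1) * ‖ξ‖ ^ 2)) Filter.atTop
        (nhds 0) := by
      simpa using ((tendsto_one_div_add_atTop_nhds_zero_nat (𝕜 := ℝ)).mul_const (‖ξ‖ ^ 2)).neg
    have h2 := ((Real.continuous_exp.tendsto _).comp h1).mul_const
      (Real.exp (-(b * ‖ξ‖ ^ (2 * α))))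
    simpa using h2

end RadialProfile

/-! ### The fractional heat kernel: scaling, time regularity, convolution law. -/

theorem fracHeatSymbol_eq {n : ℕ} {α t : ℝ} (ξ : EuclideanSpace ℝ (Fin n)) :
    Real.exp (-(t * (2 * Real.pi * ‖ξ‖) ^ (2 * α))) =
      Real.exp (-(t * (2 * Real.pi) ^ (2 * α) * ‖ξ‖ ^ (2 * α))) := by
  rw [Real.mul_rpow (by positivity) (norm_nonneg _), mul_assoc]

theorem fracHeatKernel_scale {n : ℕ} {α t c : ℝ} (hc : 0 < c) (x : EuclideanSpace ℝ (Fin n)) :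
    fracHeatKernel α (t * c ^ (2 * α)) x = (c ^ n)⁻¹ * fracHeatKernel α t (c⁻¹ • x) := by
  unfold fracHeatKernel
  rw [Real.fourierInv_eq, Real.fourierInv_eq]
  have h := Measure.integral_comp_smul (volume : Measure (EuclideanSpace ℝ (Fin n)))
    (fun ξ => Real.fourierChar (inner ℝ ξ (c⁻¹ • x)) •
      ((Real.exp (-(t * (2 * Real.pi * ‖ξ‖) ^ (2 * α))) : ℝ) : ℂ)) c
  rw [finrank_euclideanSpace_fin, abs_of_pos (by positivity)] at h
  have h' (ξ : EuclideanSpace ℝ (Fin n)) :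
      Real.fourierChar (inner ℝ (c • ξ) (c⁻¹ • x)) •
        ((Real.exp (-(t * (2 * Real.pi * ‖c • ξ‖) ^ (2 * α))) : ℝ) : ℂ) =
      Real.fourierChar (inner ℝ ξ x) •
        ((Real.exp (-(t * c ^ (2 * α) * (2 * Real.pi * ‖ξ‖) ^ (2 * α))) : ℝ) : ℂ) := by
    have h1 : inner ℝ (c • ξ) (c⁻¹ • x) = inner ℝ ξ x := by
      rw [real_inner_smul_left, real_inner_smul_right, mul_inv_cancel_left₀ hc.ne']
    have h2 : (2 * Real.pi * ‖c • ξ‖) ^ (2 * α) =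
        c ^ (2 * α) * (2 * Real.pi * ‖ξ‖) ^ (2 * α) := by
      rw [← Real.mul_rpow hc.le (by positivity), norm_smul, Real.norm_of_nonneg hc.le]
      ring_nf
    rw [h1, h2, ← mul_assoc t]
  simp_rw [h'] at h
  rw [h, Complex.smul_re, smul_eq_mul]

section HeatKernel

variable {n : ℕ} [Nontrivial (EuclideanSpace ℝ (Fin n))] {α t s : ℝ}

theorem integrable_fracHeatSymbol (hα₀ : 0 < α) (ht : 0 < t) :
    Integrable (fun ξ : EuclideanSpace ℝ (Fin n) =>
      ((Real.exp (-(t * (2 * Real.pi * ‖ξ‖) ^ (2 * α))) : ℝ) : ℂ)) := by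
  simp_rw [fracHeatSymbol_eq]
  exact (integrable_exp_neg_mul_norm_rpow (by positivity) (by positivity)).ofReal

theorem isRadialProfile_fracHeat (hα₀ : 0 < α) (hα₁ : α < 1) (ht : 0 < t) :
    IsRadialProfile (𝓕⁻ (fun ξ : EuclideanSpace ℝ (Fin n) =>
      ((Real.exp (-(t * (2 * Real.pi * ‖ξ‖) ^ (2 * α))) : ℝ) : ℂ))) := by
  simp_rw [fracHeatSymbol_eq]
  exact isRadialProfile_fourierInv_exp_neg_rpow hα₀ hα₁ (by positivity)

theorem coe_fracHeatKernel (hα₀ : 0 < α) (hα₁ : α < 1) (ht : 0 < t)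
    (x : EuclideanSpace ℝ (Fin n)) :
    ((fracHeatKernel α t x : ℝ) : ℂ) = 𝓕⁻ (fun ξ : EuclideanSpace ℝ (Fin n) =>
      ((Real.exp (-(t * (2 * Real.pi * ‖ξ‖) ^ (2 * α))) : ℝ) : ℂ)) x := by
  refine Complex.ext rfl ?_
  rw [(isRadialProfile_fracHeat hα₀ hα₁ ht).im_eq_zero, Complex.ofReal_im]

theorem fracHeatKernel_nonneg (hα₀ : 0 < α) (hα₁ : α < 1) (ht : 0 < t)
    (x : EuclideanSpace ℝ (Fin n)) : 0 ≤ fracHeatKernel α t x :=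
  (isRadialProfile_fracHeat hα₀ hα₁ ht).nonneg x

theorem fracHeatKernel_anti (hα₀ : 0 < α) (hα₁ : α < 1) (ht : 0 < t)
    {x y : EuclideanSpace ℝ (Fin n)} (h : ‖x‖ ≤ ‖y‖) :
    fracHeatKernel α t y ≤ fracHeatKernel α t x :=
  (isRadialProfile_fracHeat hα₀ hα₁ ht).anti x y h

theorem measurable_fracHeatKernel (hα₀ : 0 < α) (hα₁ : α < 1) (ht : 0 < t) :
    Measurable (fracHeatKernel α t : EuclideanSpace ℝ (Fin n) → ℝ) :=
  Complex.measurable_re.comp (isRadialProfile_fracHeat hα₀ hα₁ ht).measurable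

theorem lintegral_fracHeatKernel_le (hα₀ : 0 < α) (hα₁ : α < 1) (ht : 0 < t) :
    ∫⁻ x : EuclideanSpace ℝ (Fin n), ENNReal.ofReal (fracHeatKernel α t x) ≤ 1 :=
  (isRadialProfile_fracHeat hα₀ hα₁ ht).lintegral_le

theorem integrable_fracHeatKernel (hα₀ : 0 < α) (hα₁ : α < 1) (ht : 0 < t) :
    Integrable (fracHeatKernel α t : EuclideanSpace ℝ (Fin n) → ℝ) := by
  refine ⟨(measurable_fracHeatKernel hα₀ hα₁ ht).aestronglyMeasurable, ?_⟩
  rw [hasFiniteIntegral_iff_ofReal (.of_forall (fracHeatKernel_nonneg hα₀ hα₁ ht))]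
  exact (lintegral_fracHeatKernel_le hα₀ hα₁ ht).trans_lt ENNReal.one_lt_top

/-- The time increments of the kernel are dominated by the kernel at a comparable time. -/
theorem exists_abs_fracHeatKernel_sub_le (n : ℕ) [Nontrivial (EuclideanSpace ℝ (Fin n))]
    (hα₀ : 0 < α) (hα₁ : α < 1) :
    ∃ C : ℝ, 0 ≤ C ∧ ∀ s t : ℝ, 0 < t → 0 ≤ s → s ≤ t → ∀ y : EuclideanSpace ℝ (Fin n),
      |fracHeatKernel α (t + s) y - fracHeatKernel α t y| ≤
        C * (s / t) * fracHeatKernel α (2 ^ α * (t + s)) y := by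
  -- The factors come from `hmain`, from `hc2le`, and from the bound for (√2 c)^n, which restores
  -- the normalisation of the dominating kernel.
  refine ⟨(n + 1) * (2 ^ (1 / α)) * (√2 * 2 ^ (1 / (2 * α))) ^ n, by positivity,
    fun s t ht hs hst y => ?_⟩
  set θ := s / t with hθ
  have hθ0 : 0 ≤ θ := by positivity
  have hθ1 : θ ≤ 1 := (div_le_one ht).2 hst
  -- By scaling, K_{t+s}(y) = c^{-n} K_t(y/c), so the dilation inequality applies with ρ = 1/c; its
  -- argument ρ/√2 corresponds to the time t(√2 c)^{2α} = 2^α(t+s).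
  set c := (1 + θ) ^ (1 / (2 * α)) with hc
  have hc1 : 1 ≤ c := Real.one_le_rpow (by linarith) (by positivity)
  have hc0 : 0 < c := one_pos.trans_le hc1
  have hcα : c ^ (2 * α) = 1 + θ := by
    rw [hc, ← Real.rpow_mul (by linarith), one_div, inv_mul_cancel₀ (by positivity), Real.rpow_one]
  have hc2 : c ^ 2 = (1 + θ) ^ (1 / α) := by
    rw [hc, ← Real.rpow_natCast, ← Real.rpow_mul (by linarith)]
    congr 1
    push_cast
    field_simp
  have hcle : c ≤ 2 ^ (1 / (2 * α)) := by
    rw [hc]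
    gcongr
    linarith
  have hc2le : c ^ 2 - 1 ≤ 2 ^ (1 / α) * θ := by
    -- Chord bound for the convex power 1/α ≥ 1 between 1 and 2.
    have hconv := (convexOn_rpow (p := 1 / α) (by rw [le_div_iff₀ hα₀]; linarith)).2
      (Set.mem_Ici.2 zero_le_one) (Set.mem_Ici.2 zero_le_two) (sub_nonneg.2 hθ1) hθ0
      (sub_add_cancel 1 θ)
    simp only [smul_eq_mul, Real.one_rpow, mul_one] at hconv
    rw [hc2]
    have : 1 - θ + θ * 2 = 1 + θ := by ring
    rw [this] at hconv
    linarith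
  have hts : t + s = t * c ^ (2 * α) := by
    rw [hcα, hθ]
    field_simp
  have hts2 : 2 ^ α * (t + s) = t * (√2 * c) ^ (2 * α) := by
    rw [Real.mul_rpow (by positivity) hc0.le, hts, Real.rpow_mul (Real.sqrt_nonneg 2),
      Real.rpow_two, Real.sq_sqrt zero_le_two]
    ring
  rw [hts2, fracHeatKernel_scale (by positivity), hts, fracHeatKernel_scale hc0]
  have hρ1 : c⁻¹ ≤ 1 := inv_le_one_of_one_le₀ hc1
  have hd := (isRadialProfile_fracHeat (n := n) hα₀ hα₁ ht).dilate c⁻¹ (by positivity) hρ1 y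
  have harg : c⁻¹ / √2 = (√2 * c)⁻¹ := by rw [mul_inv, div_eq_inv_mul]
  rw [harg] at hd
  change fracHeatKernel α t (c⁻¹ • y) - fracHeatKernel α t y ≤
    ((c⁻¹ ^ 2)⁻¹ - 1) * fracHeatKernel α t ((√2 * c)⁻¹ • y) at hd
  rw [inv_pow, inv_inv] at hd
  set A := fracHeatKernel α t ((√2 * c)⁻¹ • y) with hA
  have hA0 : 0 ≤ A := fracHeatKernel_nonneg hα₀ hα₁ ht _
  have hP0 : 0 ≤ fracHeatKernel α t (c⁻¹ • y) := fracHeatKernel_nonneg hα₀ hα₁ ht _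
  have hs2 : 1 ≤ √2 := Real.one_le_sqrt.2 one_le_two
  have hPA : fracHeatKernel α t (c⁻¹ • y) ≤ A := by
    refine fracHeatKernel_anti hα₀ hα₁ ht ?_
    rw [norm_smul, norm_smul, norm_inv, norm_inv, Real.norm_of_nonneg hc0.le,
      Real.norm_of_nonneg (by positivity)]
    gcongr
    nlinarith
  have hQP : fracHeatKernel α t y ≤ fracHeatKernel α t (c⁻¹ • y) := by
    refine fracHeatKernel_anti hα₀ hα₁ ht ?_
    rw [norm_smul, norm_inv, Real.norm_of_nonneg hc0.le]
    exact mul_le_of_le_one_left (norm_nonneg _) hρ1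
  have hcn : (c ^ n)⁻¹ ≤ 1 := inv_le_one_of_one_le₀ (one_le_pow₀ hc1)
  -- Bernoulli's inequality for c⁻¹, then 1 - c⁻¹ ≤ c² - 1.
  have hbern : 1 - (c ^ n)⁻¹ ≤ n * (c ^ 2 - 1) := by
    have h1 := one_add_mul_le_pow (a := c⁻¹ - 1) (by linarith [inv_pos.2 hc0]) n
    rw [add_sub_cancel, inv_pow] at h1
    have h2 : 1 - c⁻¹ ≤ c ^ 2 - 1 := by
      have h3 : c⁻¹ * c = 1 := inv_mul_cancel₀ hc0.ne'
      nlinarith [inv_pos.2 hc0]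
    nlinarith [(Nat.cast_nonneg n : (0 : ℝ) ≤ n)]
  have hn0 : (0 : ℝ) ≤ n := Nat.cast_nonneg n
  have hc21 : 0 ≤ c ^ 2 - 1 := by nlinarith
  have hmain : |(c ^ n)⁻¹ * fracHeatKernel α t (c⁻¹ • y) - fracHeatKernel α t y| ≤
      (n + 1) * (c ^ 2 - 1) * A := by
    have hnA : 0 ≤ n * (c ^ 2 - 1) * A := by positivity
    have hnB : 0 ≤ (c ^ 2 - 1) * A := by positivity
    rw [abs_le]
    constructor
    · have h1 : (1 - (c ^ n)⁻¹) * fracHeatKernel α t (c⁻¹ • y) ≤ n * (c ^ 2 - 1) * A :=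
        mul_le_mul hbern hPA hP0 (by positivity)
      linarith
    · have h1 : (c ^ n)⁻¹ * fracHeatKernel α t (c⁻¹ • y) ≤ fracHeatKernel α t (c⁻¹ • y) :=
        mul_le_of_le_one_left hP0 hcn
      linarith
  refine hmain.trans ?_
  have hpow : (√2 * c) ^ n ≤ (√2 * 2 ^ (1 / (2 * α))) ^ n := by gcongr
  calc (n + 1) * (c ^ 2 - 1) * A ≤ (n + 1) * (2 ^ (1 / α) * θ) * A := by gcongr
    _ = (n + 1) * 2 ^ (1 / α) * (√2 * c) ^ n * θ * (((√2 * c) ^ n)⁻¹ * A) := by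
        have : (√2 * c) ^ n ≠ 0 := by positivity
        field_simp
    _ ≤ (n + 1) * 2 ^ (1 / α) * (√2 * 2 ^ (1 / (2 * α))) ^ n * θ * (((√2 * c) ^ n)⁻¹ * A) := by
        gcongr

theorem fracHeatKernel_neg (hα₀ : 0 < α) (hα₁ : α < 1) (ht : 0 < t)
    (x : EuclideanSpace ℝ (Fin n)) : fracHeatKernel α t (-x) = fracHeatKernel α t x :=
  le_antisymm (fracHeatKernel_anti hα₀ hα₁ ht (norm_neg x).ge)
    (fracHeatKernel_anti hα₀ hα₁ ht (norm_neg x).le)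

theorem fourier_fracHeatSymbol (hα₀ : 0 < α) (hα₁ : α < 1) (ht : 0 < t)
    (x : EuclideanSpace ℝ (Fin n)) :
    𝓕 (fun ξ : EuclideanSpace ℝ (Fin n) =>
      ((Real.exp (-(t * (2 * Real.pi * ‖ξ‖) ^ (2 * α))) : ℝ) : ℂ)) x = fracHeatKernel α t x := by
  rw [← fracHeatKernel_neg hα₀ hα₁ ht, coe_fracHeatKernel hα₀ hα₁ ht,
    Real.fourierInv_eq_fourier_neg, neg_neg]

theorem fourier_fracHeatKernel (hα₀ : 0 < α) (hα₁ : α < 1) (ht : 0 < t)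
    (ξ : EuclideanSpace ℝ (Fin n)) :
    𝓕 (fun x : EuclideanSpace ℝ (Fin n) => ((fracHeatKernel α t x : ℝ) : ℂ)) ξ =
      ((Real.exp (-(t * (2 * Real.pi * ‖ξ‖) ^ (2 * α))) : ℝ) : ℂ) := by
  have h1 := integrable_fracHeatSymbol (n := n) hα₀ ht
  have h2 := funext (coe_fracHeatKernel (n := n) hα₀ hα₁ ht)
  have h3 := funext (fourier_fracHeatSymbol (n := n) hα₀ hα₁ ht)
  rw [h2, Continuous.fourier_fourierInv_eq ?_ h1 ?_]
  · have : Continuous (fun ξ : EuclideanSpace ℝ (Fin n) => (2 * Real.pi * ‖ξ‖) ^ (2 * α)) :=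
      (by fun_prop : Continuous (fun ξ : EuclideanSpace ℝ (Fin n) => 2 * Real.pi * ‖ξ‖)).rpow_const
        fun _ => Or.inr (by positivity)
    fun_prop
  · rw [h3]
    exact (integrable_fracHeatKernel hα₀ hα₁ ht).ofReal

/-- K_t is the Fourier transform of its symbol. Moving that transform onto the translate of K_s
multiplies the two symbols and leaves a character, which is the Fourier integral for K_{s+t}. -/
theorem integral_fracHeatKernel_mul (hα₀ : 0 < α) (hα₁ : α < 1) (hs : 0 < s) (ht : 0 < t)
    (x : EuclideanSpace ℝ (Fin n)) :
    ∫ z, fracHeatKernel α s (x - z) * fracHeatKernel α t z = fracHeatKernel α (s + t) x := by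
  have hK := (integrable_fracHeatKernel (n := n) hα₀ hα₁ hs).ofReal (𝕜 := ℂ)
  have hflip : ∫ z, 𝓕 (fun ξ : EuclideanSpace ℝ (Fin n) =>
        ((Real.exp (-(t * (2 * Real.pi * ‖ξ‖) ^ (2 * α))) : ℝ) : ℂ)) z •
        ((fracHeatKernel α s (z - x) : ℝ) : ℂ) =
      ∫ ξ : EuclideanSpace ℝ (Fin n),
        ((Real.exp (-(t * (2 * Real.pi * ‖ξ‖) ^ (2 * α))) : ℝ) : ℂ) •
        𝓕 (fun z : EuclideanSpace ℝ (Fin n) => ((fracHeatKernel α s (z - x) : ℝ) : ℂ)) ξ := by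
    simpa using! (VectorFourier.integral_fourierIntegral_smul_eq_flip
      (L := innerₗ (EuclideanSpace ℝ (Fin n))) Real.continuous_fourierChar continuous_inner
      (integrable_fracHeatSymbol (n := n) hα₀ ht) (hK.comp_sub_right x))
  have htrans (ξ : EuclideanSpace ℝ (Fin n)) :
      𝓕 (fun z : EuclideanSpace ℝ (Fin n) => ((fracHeatKernel α s (z - x) : ℝ) : ℂ)) ξ =
        Real.fourierChar (-inner ℝ x ξ) •
          ((Real.exp (-(s * (2 * Real.pi * ‖ξ‖) ^ (2 * α))) : ℝ) : ℂ) := by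
    rw [← fourier_fracHeatKernel hα₀ hα₁ hs, Real.fourier_eq, Real.fourier_eq,
      ← integral_add_right_eq_self _ x]
    simp only [Circle.smul_def]
    rw [← integral_smul]
    refine integral_congr_ae (.of_forall fun z => ?_)
    simp only [add_sub_cancel_right, inner_add_left, neg_add, AddChar.map_add_eq_mul, Circle.coe_mul,
      smul_eq_mul]
    ring
  apply Complex.ofReal_injective
  rw [← fourier_fracHeatSymbol hα₀ hα₁ (add_pos hs ht), Real.fourier_eq, ← integral_complex_ofReal]
  simp_rw [fourier_fracHeatSymbol hα₀ hα₁ ht, htrans] at hflip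
  calc _ = _ := ?_
    _ = _ := hflip
    _ = _ := ?_
  · refine integral_congr_ae (.of_forall fun z => ?_)
    beta_reduce
    rw [← fracHeatKernel_neg hα₀ hα₁ hs, neg_sub, Complex.ofReal_mul, mul_comm, smul_eq_mul]
  · refine integral_congr_ae (.of_forall fun ξ => ?_)
    simp only [Circle.smul_def, smul_eq_mul]
    rw [real_inner_comm, mul_left_comm, ← Complex.ofReal_mul, ← Real.exp_add]
    ring_nf

end HeatKernel

/-! ### Maximal functions and radial kernels. -/

section Maximal

variable {n : ℕ} {𝕜 : Type*} [RCLike 𝕜] {q : ℝ} {f g : EuclideanSpace ℝ (Fin n) → 𝕜}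

theorem setLIntegral_ball_le_maximalFn (g : EuclideanSpace ℝ (Fin n) → 𝕜)
    (x : EuclideanSpace ℝ (Fin n)) {r : ℝ} (hr : 0 < r) :
    ∫⁻ y in ball x r, ‖g y‖ₑ ≤ volume (ball x r) * maximalFn g x := by
  have h0 : volume (ball x r) ≠ 0 := (measure_ball_pos _ _ hr).ne'
  have h1 : volume (ball x r) ≠ ∞ := measure_ball_lt_top.ne
  calc ∫⁻ y in ball x r, ‖g y‖ₑ
      = volume (ball x r) * ((volume (ball x r))⁻¹ * ∫⁻ y in ball x r, ‖g y‖ₑ) := by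
        rw [← mul_assoc, ENNReal.mul_inv_cancel h0 h1, one_mul]
    _ ≤ volume (ball x r) * maximalFn g x := by
        gcongr
        exact le_iSup₂ (f := fun (r : ℝ) (_ : 0 < r) =>
          (volume (ball x r))⁻¹ * ∫⁻ y in ball x r, ‖g y‖ₑ) r hr

/-- The maximal function controls integrals over sets which are balls centred at `x` up to their
boundary. -/
theorem setLIntegral_le_maximalFn [Nontrivial (EuclideanSpace ℝ (Fin n))]
    (g : EuclideanSpace ℝ (Fin n) → 𝕜) {x : EuclideanSpace ℝ (Fin n)}
    {S : Set (EuclideanSpace ℝ (Fin n))}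
    (hS : ∀ y ∈ S, ∀ z, dist z x ≤ dist y x → z ∈ S) (hfin : volume S ≠ ∞) :
    ∫⁻ y in S, ‖g y‖ₑ ≤ volume S * maximalFn g x := by
  have hbdd : BddAbove ((fun y => dist y x) '' S) := by
    by_contra h
    rw [not_bddAbove_iff] at h
    have : S = Set.univ := by
      refine Set.eq_univ_of_forall fun z => ?_
      obtain ⟨_, ⟨y, hy, rfl⟩, hlt⟩ := h (dist z x)
      exact hS y hy z hlt.le
    rw [this] at hfin
    exact hfin (measure_univ_of_isAddLeftInvariant _)
  set r := sSup ((fun y => dist y x) '' S) with hr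
  have hsub : S ⊆ closedBall x r := fun y hy => le_csSup hbdd ⟨y, hy, rfl⟩
  have hball : ball x r ⊆ S := by
    intro z hz
    have hne : ((fun y => dist y x) '' S).Nonempty := by
      by_contra hne
      rw [Set.not_nonempty_iff_eq_empty] at hne
      rw [hr, hne, Real.sSup_empty] at hz
      simp at hz
    obtain ⟨_, ⟨y, hy, rfl⟩, hlt⟩ := exists_lt_of_lt_csSup hne (mem_ball.1 hz)
    exact hS y hy z hlt.le
  have hae : ball x r =ᵐ[volume] closedBall x r :=
    ae_eq_of_subset_of_measure_ge ball_subset_closedBall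
      (Measure.addHaar_closedBall_eq_addHaar_ball volume x r).le
      measurableSet_ball.nullMeasurableSet measure_closedBall_lt_top.ne
  -- The case `r ≤ 0` includes empty `S`, where `sSup` defaults to 0, and `S` reduced to the centre;
  -- both are null.
  rcases le_or_gt r 0 with hr0 | hr0
  · have : volume S = 0 := by
      refine measure_mono_null hsub ?_
      rw [← measure_congr hae, ball_eq_empty.2 hr0, measure_empty]
    rw [setLIntegral_measure_zero _ _ this]
    exact zero_le
  · calc ∫⁻ y in S, ‖g y‖ₑ ≤ ∫⁻ y in closedBall x r, ‖g y‖ₑ := lintegral_mono_set hsub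
      _ = ∫⁻ y in ball x r, ‖g y‖ₑ := (setLIntegral_congr hae).symm
      _ ≤ volume (ball x r) * maximalFn g x := setLIntegral_ball_le_maximalFn g x hr0
      _ ≤ volume S * maximalFn g x := by gcongr

/-- Layer-cake formula: the superlevel sets of k(x - ·) are balls about x up to their boundary, of
finite volume by Markov's inequality. -/
theorem lintegral_radial_mul_le_maximalFn [Nontrivial (EuclideanSpace ℝ (Fin n))]
    {k : EuclideanSpace ℝ (Fin n) → ℝ} (hk : Measurable k) (hk0 : ∀ x, 0 ≤ k x)
    (hanti : ∀ x y, ‖x‖ ≤ ‖y‖ → k y ≤ k x) (hk1 : ∫⁻ x, ENNReal.ofReal (k x) ≤ 1)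
    (hg : AEStronglyMeasurable g volume) (x : EuclideanSpace ℝ (Fin n)) :
    ∫⁻ y, ENNReal.ofReal (k (x - y)) * ‖g y‖ₑ ≤ maximalFn g x := by
  rcases eq_or_ne (maximalFn g x) ∞ with hM | hM
  · rw [hM]; exact le_top
  have hkm : Measurable (fun y => k (x - y)) := hk.comp (measurable_const.sub measurable_id)
  have hk1' : ∫⁻ y, ENNReal.ofReal (k (x - y)) ≤ 1 := by
    rwa [lintegral_sub_left_eq_self (fun y => ENNReal.ofReal (k y)) x]
  have hlevel (c : ℝ) (hc : 0 < c) : volume {y | c < k (x - y)} ≠ ∞ := by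
    have h1 := mul_meas_ge_le_lintegral (μ := volume) hkm.ennreal_ofReal (ENNReal.ofReal c)
    have h2 : volume {y | c < k (x - y)} ≤
        volume {y | ENNReal.ofReal c ≤ ENNReal.ofReal (k (x - y))} :=
      measure_mono fun y hy => ENNReal.ofReal_le_ofReal (le_of_lt hy)
    intro htop
    rw [htop, top_le_iff] at h2
    rw [h2, ENNReal.mul_top (by simpa using hc)] at h1
    exact absurd (h1.trans hk1') (by simp)
  calc ∫⁻ y, ENNReal.ofReal (k (x - y)) * ‖g y‖ₑ
      = ∫⁻ y, ENNReal.ofReal (k (x - y)) ∂(volume.withDensity fun y => ‖g y‖ₑ) := by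
        rw [lintegral_withDensity_eq_lintegral_mul₀ hg.enorm hkm.ennreal_ofReal.aemeasurable]
        exact lintegral_congr fun y => mul_comm _ _
    _ = ∫⁻ c in Set.Ioi 0, (volume.withDensity fun y => ‖g y‖ₑ) {y | c < k (x - y)} :=
        lintegral_eq_lintegral_meas_lt _ (.of_forall fun y => hk0 _) hkm.aemeasurable
    _ ≤ ∫⁻ c in Set.Ioi 0, volume {y | c < k (x - y)} * maximalFn g x := by
        refine lintegral_mono_ae ?_
        filter_upwards [ae_restrict_mem measurableSet_Ioi] with c hc
        rw [withDensity_apply _ (measurableSet_lt measurable_const hkm)]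
        refine setLIntegral_le_maximalFn g (fun y hy z hz => ?_) (hlevel c hc)
        refine lt_of_lt_of_le hy (hanti _ _ ?_)
        rwa [← dist_eq_norm, ← dist_eq_norm, dist_comm x, dist_comm x]
    _ = (∫⁻ y, ENNReal.ofReal (k (x - y))) * maximalFn g x := by
        rw [lintegral_mul_const' _ _ hM,
          ← lintegral_eq_lintegral_meas_lt _ (.of_forall fun y => hk0 _) hkm.aemeasurable]
    _ ≤ 1 * maximalFn g x := by gcongr
    _ = maximalFn g x := one_mul _

/-- Monotonicity of L^p norms in p for the normalised measure on each ball. -/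
theorem maximalFn_le_maximalFnPow (hq : 1 ≤ q) (hf : AEStronglyMeasurable f volume)
    (x : EuclideanSpace ℝ (Fin n)) : maximalFn f x ≤ maximalFnPow q f x := by
  refine iSup₂_mono fun r hr => ?_
  have h0 : volume (ball x r) ≠ 0 := (measure_ball_pos _ _ hr).ne'
  have h1 : volume (ball x r) ≠ ∞ := measure_ball_lt_top.ne
  have hP : IsProbabilityMeasure ((volume (ball x r))⁻¹ • volume.restrict (ball x r)) :=
    ⟨by simp [ENNReal.inv_mul_cancel h0 h1]⟩
  have h := eLpNorm_le_eLpNorm_of_exponent_le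
    (μ := (volume (ball x r))⁻¹ • volume.restrict (ball x r)) (f := f) (p := 1)
    (q := ENNReal.ofReal q) (by simpa using hq)
    ((hf.mono_measure Measure.restrict_le_self).smul_measure _)
  rw [eLpNorm_one_eq_lintegral_enorm, eLpNorm_eq_lintegral_rpow_enorm_toReal (by simp; linarith)
    ENNReal.ofReal_ne_top, ENNReal.toReal_ofReal (by linarith), lintegral_smul_measure,
    lintegral_smul_measure] at h
  exact h

end Maximal

/-! ### The semigroup acting on functions with finite maximal function at a point. -/

section FracHeat

variable {n : ℕ} [Nontrivial (EuclideanSpace ℝ (Fin n))] {α t s : ℝ} {𝕜 : Type*} [RCLike 𝕜]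
  {f g : EuclideanSpace ℝ (Fin n) → 𝕜}

theorem lintegral_fracHeatKernel_mul_le (hα₀ : 0 < α) (hα₁ : α < 1) (ht : 0 < t)
    (hf : AEStronglyMeasurable f volume) (x : EuclideanSpace ℝ (Fin n)) :
    ∫⁻ y, ENNReal.ofReal (fracHeatKernel α t (x - y)) * ‖f y‖ₑ ≤ maximalFn f x :=
  lintegral_radial_mul_le_maximalFn (measurable_fracHeatKernel hα₀ hα₁ ht)
    (fracHeatKernel_nonneg hα₀ hα₁ ht) (fun _ _ => fracHeatKernel_anti hα₀ hα₁ ht)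
    (lintegral_fracHeatKernel_le hα₀ hα₁ ht) hf x

theorem enorm_fracHeatKernel_smul (hα₀ : 0 < α) (hα₁ : α < 1) (ht : 0 < t)
    (x : EuclideanSpace ℝ (Fin n)) (c : 𝕜) :
    ‖fracHeatKernel α t x • c‖ₑ = ENNReal.ofReal (fracHeatKernel α t x) * ‖c‖ₑ := by
  rw [enorm_smul, Real.enorm_of_nonneg (fracHeatKernel_nonneg hα₀ hα₁ ht x)]

theorem aestronglyMeasurable_fracHeatKernel_smul (hα₀ : 0 < α) (hα₁ : α < 1) (ht : 0 < t)
    (hf : AEStronglyMeasurable f volume) (x : EuclideanSpace ℝ (Fin n)) :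
    AEStronglyMeasurable (fun y => fracHeatKernel α t (x - y) • f y) volume :=
  ((measurable_fracHeatKernel hα₀ hα₁ ht).comp
    (measurable_const.sub measurable_id)).aestronglyMeasurable.smul hf

theorem integrable_fracHeatKernel_smul (hα₀ : 0 < α) (hα₁ : α < 1) (ht : 0 < t)
    (hf : AEStronglyMeasurable f volume) {x : EuclideanSpace ℝ (Fin n)}
    (hM : maximalFn f x ≠ ∞) : Integrable (fun y => fracHeatKernel α t (x - y) • f y) := by
  refine ⟨aestronglyMeasurable_fracHeatKernel_smul hα₀ hα₁ ht hf x, ?_⟩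
  simp_rw [HasFiniteIntegral, enorm_fracHeatKernel_smul hα₀ hα₁ ht]
  exact (lintegral_fracHeatKernel_mul_le hα₀ hα₁ ht hf x).trans_lt hM.lt_top

theorem enorm_fracHeat_le (hα₀ : 0 < α) (hα₁ : α < 1) (ht : 0 < t)
    (hf : AEStronglyMeasurable f volume) (x : EuclideanSpace ℝ (Fin n)) :
    ‖fracHeat α t f x‖ₑ ≤ maximalFn f x := by
  refine (enorm_integral_le_lintegral_enorm _).trans ?_
  simp_rw [enorm_fracHeatKernel_smul hα₀ hα₁ ht]
  exact lintegral_fracHeatKernel_mul_le hα₀ hα₁ ht hf x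

/-- The kernel dominating the time increment is again radially decreasing of mass at most 1, so only
the factor C s/t remains in front of the maximal function. -/
theorem exists_enorm_fracHeat_sub_le (n : ℕ) [Nontrivial (EuclideanSpace ℝ (Fin n))]
    (hα₀ : 0 < α) (hα₁ : α < 1) :
    ∃ C : ℝ, 0 ≤ C ∧ ∀ (𝕜 : Type) [RCLike 𝕜] (f : EuclideanSpace ℝ (Fin n) → 𝕜),
      AEStronglyMeasurable f volume → ∀ x, maximalFn f x ≠ ∞ →
      ∀ s t : ℝ, 0 < t → 0 ≤ s → s ≤ t →
        ‖fracHeat α (t + s) f x - fracHeat α t f x‖ₑ ≤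
          ENNReal.ofReal (C * (s / t)) * maximalFn f x := by
  obtain ⟨C, hC, h⟩ := exists_abs_fracHeatKernel_sub_le n hα₀ hα₁
  refine ⟨C, hC, fun 𝕜 _ f hf x hM s t ht hs hst => ?_⟩
  have hts : 0 < t + s := by linarith
  have hts2 : 0 < 2 ^ α * (t + s) := by positivity
  unfold fracHeat
  rw [← integral_sub (integrable_fracHeatKernel_smul hα₀ hα₁ hts hf hM)
    (integrable_fracHeatKernel_smul hα₀ hα₁ ht hf hM)]
  calc _ ≤ ∫⁻ y, ‖fracHeatKernel α (t + s) (x - y) • f y -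
        fracHeatKernel α t (x - y) • f y‖ₑ := enorm_integral_le_lintegral_enorm _
    _ ≤ ∫⁻ y, ENNReal.ofReal (C * (s / t)) *
        (ENNReal.ofReal (fracHeatKernel α (2 ^ α * (t + s)) (x - y)) * ‖f y‖ₑ) := by
        refine lintegral_mono fun y => ?_
        rw [← sub_smul, enorm_smul, ← mul_assoc, ← ENNReal.ofReal_mul (by positivity),
          ← ofReal_norm, Real.norm_eq_abs]
        gcongr
        exact h s t ht hs hst _
    _ = ENNReal.ofReal (C * (s / t)) *
        ∫⁻ y, ENNReal.ofReal (fracHeatKernel α (2 ^ α * (t + s)) (x - y)) * ‖f y‖ₑ :=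
        lintegral_const_mul' _ _ ENNReal.ofReal_ne_top
    _ ≤ _ := by
        gcongr
        exact lintegral_fracHeatKernel_mul_le hα₀ hα₁ hts2 hf x

theorem integral_fracHeatKernel_sub_mul (hα₀ : 0 < α) (hα₁ : α < 1) (hs : 0 < s) (ht : 0 < t)
    (x y : EuclideanSpace ℝ (Fin n)) :
    ∫ z, fracHeatKernel α s (x - z) * fracHeatKernel α t (z - y) =
      fracHeatKernel α (s + t) (x - y) := by
  rw [← integral_fracHeatKernel_mul hα₀ hα₁ hs ht, ← integral_sub_right_eq_self
    (fun z => fracHeatKernel α s (x - y - z) * fracHeatKernel α t z) y]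
  simp_rw [sub_sub_sub_cancel_right]

theorem lintegral_fracHeatKernel_sub_mul (hα₀ : 0 < α) (hα₁ : α < 1) (hs : 0 < s) (ht : 0 < t)
    (x y : EuclideanSpace ℝ (Fin n)) :
    ∫⁻ z, ENNReal.ofReal (fracHeatKernel α s (x - z)) *
      ENNReal.ofReal (fracHeatKernel α t (z - y)) =
      ENNReal.ofReal (fracHeatKernel α (s + t) (x - y)) := by
  have hms := measurable_fracHeatKernel (n := n) hα₀ hα₁ hs
  have hmt := measurable_fracHeatKernel (n := n) hα₀ hα₁ ht
  rw [← integral_fracHeatKernel_sub_mul hα₀ hα₁ hs ht, ofReal_integral_eq_lintegral_ofReal]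
  · exact lintegral_congr fun z => (ENNReal.ofReal_mul (fracHeatKernel_nonneg hα₀ hα₁ hs _)).symm
  · refine (((integrable_fracHeatKernel hα₀ hα₁ ht).comp_sub_right y).const_mul
      (fracHeatKernel α s (0 : EuclideanSpace ℝ (Fin n)))).mono' ?_ (.of_forall fun z => ?_)
    · exact ((hms.comp (measurable_const.sub measurable_id)).mul
        (hmt.comp (measurable_id.sub measurable_const))).aestronglyMeasurable
    · have h1 := fracHeatKernel_nonneg hα₀ hα₁ hs (x - z)
      have h2 := fracHeatKernel_nonneg hα₀ hα₁ ht (z - y)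
      rw [Real.norm_of_nonneg (mul_nonneg h1 h2)]
      gcongr
      exact fracHeatKernel_anti hα₀ hα₁ hs (by simp)
  · exact .of_forall fun z => mul_nonneg (fracHeatKernel_nonneg hα₀ hα₁ hs _)
      (fracHeatKernel_nonneg hα₀ hα₁ ht _)

theorem integrable_fracHeatKernel_prod (hα₀ : 0 < α) (hα₁ : α < 1) (hs : 0 < s) (ht : 0 < t)
    (hf : AEStronglyMeasurable f volume) {x : EuclideanSpace ℝ (Fin n)}
    (hM : maximalFn f x ≠ ∞) :
    Integrable (Function.uncurry fun z y =>
      fracHeatKernel α s (x - z) • fracHeatKernel α t (z - y) • f y)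
      ((volume : Measure (EuclideanSpace ℝ (Fin n))).prod volume) := by
  have hms := measurable_fracHeatKernel (n := n) hα₀ hα₁ hs
  have hmt := measurable_fracHeatKernel (n := n) hα₀ hα₁ ht
  have hmeas : AEStronglyMeasurable (Function.uncurry fun z y =>
      fracHeatKernel α s (x - z) • fracHeatKernel α t (z - y) • f y)
      ((volume : Measure (EuclideanSpace ℝ (Fin n))).prod volume) :=
    (hms.comp (measurable_const.sub measurable_fst)).aestronglyMeasurable.smul
      ((hmt.comp (measurable_fst.sub measurable_snd)).aestronglyMeasurable.smul hf.comp_snd)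
  refine ⟨hmeas, ?_⟩
  -- Integrating in z before y turns the double integral into K_{s+t} * |f| at x, which the maximal
  -- function bounds.
  rw [HasFiniteIntegral, lintegral_prod_symm _ hmeas.enorm]
  refine lt_of_le_of_lt (le_of_eq ?_)
    ((lintegral_fracHeatKernel_mul_le hα₀ hα₁ (add_pos hs ht) hf x).trans_lt hM.lt_top)
  refine lintegral_congr fun y => ?_
  simp only [Function.uncurry_apply_pair, enorm_fracHeatKernel_smul hα₀ hα₁ hs,
    enorm_fracHeatKernel_smul hα₀ hα₁ ht, ← mul_assoc]
  rw [lintegral_mul_const' _ _ enorm_ne_top, lintegral_fracHeatKernel_sub_mul hα₀ hα₁ hs ht]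

theorem integrable_fracHeatKernel_smul_fracHeat (hα₀ : 0 < α) (hα₁ : α < 1) (hs : 0 < s)
    (ht : 0 < t) (hf : AEStronglyMeasurable f volume) {x : EuclideanSpace ℝ (Fin n)}
    (hM : maximalFn f x ≠ ∞) :
    Integrable (fun z => fracHeatKernel α s (x - z) • fracHeat α t f z) := by
  refine (integrable_fracHeatKernel_prod hα₀ hα₁ hs ht hf hM).integral_prod_left.congr
    (.of_forall fun z => ?_)
  exact integral_smul (fracHeatKernel α s (x - z)) (fun y => fracHeatKernel α t (z - y) • f y)

/-- The semigroup law. -/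
theorem fracHeat_fracHeat (hα₀ : 0 < α) (hα₁ : α < 1) (hs : 0 < s) (ht : 0 < t)
    (hf : AEStronglyMeasurable f volume) {x : EuclideanSpace ℝ (Fin n)}
    (hM : maximalFn f x ≠ ∞) :
    fracHeat α s (fracHeat α t f) x = fracHeat α (s + t) f x := by
  have h := integral_integral_swap (integrable_fracHeatKernel_prod hα₀ hα₁ hs ht hf hM)
  unfold fracHeat
  simp_rw [← integral_smul]
  rw [h]
  refine integral_congr_ae (.of_forall fun y => ?_)
  simp only [smul_smul]
  rw [integral_smul_const, integral_fracHeatKernel_sub_mul hα₀ hα₁ hs ht]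

theorem aestronglyMeasurable_fracHeat (hα₀ : 0 < α) (hα₁ : α < 1) (ht : 0 < t)
    (hf : AEStronglyMeasurable f volume) : AEStronglyMeasurable (fracHeat α t f) volume := by
  have hmt := measurable_fracHeatKernel (n := n) hα₀ hα₁ ht
  have hmeas : AEStronglyMeasurable (fun p : EuclideanSpace ℝ (Fin n) × EuclideanSpace ℝ (Fin n) =>
      fracHeatKernel α t (p.1 - p.2) • f p.2) (volume.prod volume) :=
    (hmt.comp (measurable_fst.sub measurable_snd)).aestronglyMeasurable.smul hf.comp_snd
  exact hmeas.integral_prod_right'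

end FracHeat

/-! ### Summation along lacunary sequences. -/

theorem IsLacunary.le_pow_mul {lam : ℝ} {a : ℤ → ℝ} (ha : IsLacunary lam a) (hlam : 0 < lam)
    (j : ℤ) (k : ℕ) : a j ≤ lam⁻¹ ^ k * a (j + k) := by
  induction k with
  | zero => simp
  | succ k ih =>
    have h1 := (le_div_iff₀ (ha.1 (j + k))).1 (ha.2 (j + k))
    have h2 : a (j + k) ≤ lam⁻¹ * a (j + k + 1) := by
      rw [inv_mul_eq_div, le_div_iff₀ hlam]
      linarith
    calc a j ≤ lam⁻¹ ^ k * a (j + k) := ih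
      _ ≤ lam⁻¹ ^ k * (lam⁻¹ * a (j + k + 1)) := by gcongr
      _ = lam⁻¹ ^ (k + 1) * a (j + (k + 1 : ℕ)) := by
        rw [pow_succ, mul_assoc]
        push_cast
        rw [add_assoc]

theorem sum_pow_le_of_injOn {ι : Type*} {r : ℝ} (h0 : 0 ≤ r) (h1 : r < 1) (S : Finset ι)
    {e : ι → ℕ} (he : Set.InjOn e S) : ∑ j ∈ S, r ^ e j ≤ (1 - r)⁻¹ := by
  rw [← Finset.sum_image (f := fun k => r ^ k) he, ← tsum_geometric_of_lt_one h0 h1]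
  exact (summable_geometric_of_lt_one h0 h1).sum_le_tsum _ fun k _ => by positivity

theorem sum_pow_natAbs_le {r : ℝ} (h0 : 0 ≤ r) (h1 : r < 1) (S : Finset ℤ) (m : ℤ) :
    ∑ j ∈ S, r ^ (j - m).natAbs ≤ 2 * (1 - r)⁻¹ := by
  rw [← Finset.sum_filter_add_sum_filter_not S (fun j => m ≤ j), two_mul]
  refine add_le_add (sum_pow_le_of_injOn h0 h1 _ fun i hi j hj h => ?_)
    (sum_pow_le_of_injOn h0 h1 _ fun i hi j hj h => ?_)
  all_goals
    simp only [Finset.coe_filter, Set.mem_ofPred_eq] at hi hj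
    omega

/-- Smoothing a sum of differences along a lacunary sequence by the time shift `a m` amounts to
discarding the terms before `m`, up to a bounded error. -/
theorem norm_tail_sub_shift_le {E : Type*} [NormedAddCommGroup E] [NormedSpace ℝ E]
    {lam V D : ℝ} (hlam : 1 < lam) (hD : 0 ≤ D) {a v : ℤ → ℝ} (ha : IsLacunary lam a)
    (hv : ∀ j, |v j| ≤ V) {H : ℝ → E}
    (hH : ∀ s t : ℝ, 0 < t → 0 ≤ s → s ≤ t → ‖H (t + s) - H t‖ ≤ D * (s / t))
    {L m M : ℤ} (hm : L ≤ m) :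
    ‖∑ j ∈ Finset.Icc m M, v j • (H (a (j + 1)) - H (a j)) -
        ∑ j ∈ Finset.Icc L M, v j • (H (a m + a (j + 1)) - H (a m + a j))‖ ≤
      V * (2 * D * lam) * (2 * (1 - lam⁻¹)⁻¹) := by
  have hlam0 : 0 < lam := by linarith
  have hr0 : 0 < lam⁻¹ := by positivity
  have hr1 : lam⁻¹ < 1 := inv_lt_one_of_one_lt₀ hlam
  have hV : 0 ≤ V := (abs_nonneg _).trans (hv 0)
  have hpos := ha.1
  have hstep (j : ℤ) : a j ≤ a (j + 1) := by
    have h := ha.le_pow_mul hlam0 j 1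
    rw [pow_one, Nat.cast_one] at h
    nlinarith [hpos (j + 1)]
  have hratio {i j : ℤ} (hij : i ≤ j) : a i / a j ≤ lam⁻¹ ^ (j - i).natAbs := by
    obtain ⟨k, rfl⟩ := Int.le.dest hij
    rw [div_le_iff₀ (hpos _), add_sub_cancel_left, Int.natAbs_natCast]
    exact ha.le_pow_mul hlam0 i k
  -- One factor `lam` absorbs the shift between j and j + 1 in the exponent.
  have hr_le {k l : ℕ} (h : k ≤ l + 1) : lam⁻¹ ^ l ≤ lam * lam⁻¹ ^ k := by
    calc lam⁻¹ ^ l = lam * lam⁻¹ ^ (l + 1) := by rw [pow_succ]; field_simp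
      _ ≤ lam * lam⁻¹ ^ k := by
        have := pow_le_pow_of_le_one hr0.le hr1.le h
        gcongr
  have hfilter : Finset.Icc m M = (Finset.Icc L M).filter (fun j => m ≤ j) := by
    ext j
    simp only [Finset.mem_Icc, Finset.mem_filter]
    omega
  rw [hfilter, Finset.sum_filter, ← Finset.sum_sub_distrib]
  have hterm (j : ℤ) : ‖(if m ≤ j then v j • (H (a (j + 1)) - H (a j)) else 0) -
      v j • (H (a m + a (j + 1)) - H (a m + a j))‖ ≤
      V * (2 * D * lam) * lam⁻¹ ^ (j - m).natAbs := by
    by_cases hj : m ≤ j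
    · have hmono : a m ≤ a j := by
        have := hratio hj
        rw [div_le_iff₀ (hpos _)] at this
        exact this.trans (mul_le_of_le_one_left (hpos j).le (pow_le_one₀ hr0.le hr1.le))
      rw [if_pos hj, ← smul_sub, norm_smul, Real.norm_eq_abs]
      have e1 := hH (a m) (a (j + 1)) (hpos _) (hpos _).le (hmono.trans (hstep j))
      have e2 := hH (a m) (a j) (hpos _) (hpos _).le hmono
      have e3 : a m / a (j + 1) ≤ lam * lam⁻¹ ^ (j - m).natAbs :=
        (hratio (by omega)).trans (hr_le (by omega))
      have e4 : a m / a j ≤ lam * lam⁻¹ ^ (j - m).natAbs := (hratio hj).trans (hr_le (by omega))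
      -- Regrouped, the error consists of two shifts by a_m, from the base times a_j and a_{j+1}.
      have e5 : ‖H (a (j + 1)) - H (a j) - (H (a m + a (j + 1)) - H (a m + a j))‖ ≤
          2 * D * lam * lam⁻¹ ^ (j - m).natAbs := by
        calc _ = ‖(H (a j + a m) - H (a j)) - (H (a (j + 1) + a m) - H (a (j + 1)))‖ := by
              rw [add_comm (a j), add_comm (a (j + 1))]
              congr 1
              abel
          _ ≤ D * (a m / a j) + D * (a m / a (j + 1)) := (norm_sub_le _ _).trans (add_le_add e2 e1)
          _ ≤ D * (lam * lam⁻¹ ^ (j - m).natAbs) + D * (lam * lam⁻¹ ^ (j - m).natAbs) := by gcongr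
          _ = _ := by ring
      calc _ ≤ V * (2 * D * lam * lam⁻¹ ^ (j - m).natAbs) := by
            gcongr
            exact hv j
        _ = _ := by ring
    · have hle : a (j + 1) ≤ a m := by
        have := hratio (show j + 1 ≤ m by omega)
        rw [div_le_iff₀ (hpos _)] at this
        exact this.trans (mul_le_of_le_one_left (hpos m).le (pow_le_one₀ hr0.le hr1.le))
      have hj0 := hpos j
      rw [if_neg hj, zero_sub, norm_neg, norm_smul, Real.norm_eq_abs]
      -- Now the roles are exchanged: the small increment is a_{j+1} - a_j ≤ a_m and the base time
      -- is a_m + a_j.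
      have e1 := hH (a (j + 1) - a j) (a m + a j) (by linarith [hpos m])
        (by linarith [hstep j]) (by linarith)
      rw [add_add_sub_cancel] at e1
      have e2 : (a (j + 1) - a j) / (a m + a j) ≤ lam * lam⁻¹ ^ (j - m).natAbs := by
        calc _ ≤ a (j + 1) / a m := by
              have := hpos (j + 1)
              have := hpos m
              gcongr <;> linarith
          _ ≤ lam⁻¹ ^ (m - (j + 1)).natAbs := hratio (by omega)
          _ ≤ _ := hr_le (by omega)
      calc _ ≤ V * (D * (lam * lam⁻¹ ^ (j - m).natAbs)) := by
            gcongr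
            · exact hv j
            · exact e1.trans (by gcongr)
        _ ≤ 2 * (V * (D * (lam * lam⁻¹ ^ (j - m).natAbs))) := by
            have : 0 ≤ V * (D * (lam * lam⁻¹ ^ (j - m).natAbs)) := by positivity
            linarith
        _ = _ := by ring
  calc _ ≤ ∑ j ∈ Finset.Icc L M, V * (2 * D * lam) * lam⁻¹ ^ (j - m).natAbs :=
        norm_sum_le_of_le _ fun j _ => hterm j
    _ = V * (2 * D * lam) * ∑ j ∈ Finset.Icc L M, lam⁻¹ ^ (j - m).natAbs :=
        (Finset.mul_sum _ _ _).symm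
    _ ≤ _ := by
        have := sum_pow_natAbs_le hr0.le hr1 (Finset.Icc L M) m
        gcongr

/-! ### Tails of the difference transform and the maximal inequality. -/

section DiffTransform

variable {n : ℕ} {α : ℝ} {𝕜 : Type*} [RCLike 𝕜] {f : EuclideanSpace ℝ (Fin n) → 𝕜}

theorem diffTransform_eq_sub {a v : ℤ → ℝ} {N₁ N₂ M : ℤ} (h₁ : N₁ ≤ N₂ + 1) (h₂ : N₂ ≤ M)
    (x : EuclideanSpace ℝ (Fin n)) :
    diffTransform α a v N₁ N₂ f x =
      diffTransform α a v N₁ M f x - diffTransform α a v (N₂ + 1) M f x := by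
  unfold diffTransform
  rw [eq_sub_iff_add_eq, ← Finset.sum_union]
  · congr 1
    ext j
    simp only [Finset.mem_union, Finset.mem_Icc]
    omega
  · rw [Finset.disjoint_left]
    intro j
    simp only [Finset.mem_Icc]
    omega

variable [Nontrivial (EuclideanSpace ℝ (Fin n))]

theorem aestronglyMeasurable_diffTransform (hα₀ : 0 < α) (hα₁ : α < 1) {a v : ℤ → ℝ}
    (ha : ∀ j, 0 < a j) (N₁ N₂ : ℤ) (hf : AEStronglyMeasurable f volume) :
    AEStronglyMeasurable (diffTransform α a v N₁ N₂ f) volume := by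
  refine Finset.aestronglyMeasurable_fun_sum _ fun j _ => ?_
  exact ((aestronglyMeasurable_fracHeat hα₀ hα₁ (ha _) hf).sub
    (aestronglyMeasurable_fracHeat hα₀ hα₁ (ha _) hf)).const_smul _

theorem fracHeat_diffTransform (hα₀ : 0 < α) (hα₁ : α < 1) {a v : ℤ → ℝ} (ha : ∀ j, 0 < a j)
    {s : ℝ} (hs : 0 < s) (N₁ N₂ : ℤ) (hf : AEStronglyMeasurable f volume)
    {x : EuclideanSpace ℝ (Fin n)} (hM : maximalFn f x ≠ ∞) :
    fracHeat α s (diffTransform α a v N₁ N₂ f) x =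
      ∑ j ∈ Finset.Icc N₁ N₂,
        v j • (fracHeat α (s + a (j + 1)) f x - fracHeat α (s + a j) f x) := by
  have hi (j : ℤ) := integrable_fracHeatKernel_smul_fracHeat hα₀ hα₁ hs (ha j) hf hM
  have h1 (z : EuclideanSpace ℝ (Fin n)) :
      fracHeatKernel α s (x - z) • diffTransform α a v N₁ N₂ f z =
        ∑ j ∈ Finset.Icc N₁ N₂, v j • (fracHeatKernel α s (x - z) • fracHeat α (a (j + 1)) f z -
          fracHeatKernel α s (x - z) • fracHeat α (a j) f z) := by
    unfold diffTransform
    rw [Finset.smul_sum]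
    refine Finset.sum_congr rfl fun j _ => ?_
    rw [smul_comm, smul_sub]
  rw [fracHeat]
  simp_rw [h1]
  rw [integral_finsetSum]
  swap
  · exact fun j _ => ((hi (j + 1)).sub (hi j)).smul (v j)
  refine Finset.sum_congr rfl fun j _ => ?_
  rw [integral_smul, integral_sub (hi _) (hi _), ← fracHeat_fracHeat hα₀ hα₁ hs (ha _) hf hM,
    ← fracHeat_fracHeat hα₀ hα₁ hs (ha _) hf hM]
  rfl

/-- The value m = M + 1, with an empty tail, is admitted because it occurs when N₂ = M. -/
theorem exists_enorm_diffTransform_tail_le (n : ℕ) [Nontrivial (EuclideanSpace ℝ (Fin n))]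
    (hα₀ : 0 < α) (hα₁ : α < 1) {lam : ℝ} (hlam : 1 < lam) (V : ℝ) :
    ∃ C : ℝ≥0, ∀ (a v : ℤ → ℝ), IsLacunary lam a → (∀ j, |v j| ≤ V) →
      ∀ (𝕜 : Type) [RCLike 𝕜] (f : EuclideanSpace ℝ (Fin n) → 𝕜),
        AEStronglyMeasurable f volume → ∀ x, maximalFn f x ≠ ∞ → ∀ m M : ℤ, -M ≤ m →
          ‖diffTransform α a v m M f x‖ₑ ≤
            maximalFn (diffTransform α a v (-M) M f) x + C * maximalFn f x := by
  obtain ⟨C, hC, h⟩ := exists_enorm_fracHeat_sub_le n hα₀ hα₁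
  have hr1 : lam⁻¹ < 1 := inv_lt_one_of_one_lt₀ hlam
  refine ⟨(V * (2 * C * lam) * (2 * (1 - lam⁻¹)⁻¹)).toNNReal,
    fun a v ha hv 𝕜 _ f hf x hM m M hm => ?_⟩
  have hV : 0 ≤ V := (abs_nonneg _).trans (hv 0)
  have hB : 0 ≤ V * (2 * C * lam) * (2 * (1 - lam⁻¹)⁻¹) := by
    have : 0 < 1 - lam⁻¹ := by linarith
    have : 0 < lam := by linarith
    positivity
  set D := (maximalFn f x).toReal with hD
  have hD0 : 0 ≤ D := ENNReal.toReal_nonneg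
  have hMD : maximalFn f x = ENNReal.ofReal D := (ENNReal.ofReal_toReal hM).symm
  have hH (s t : ℝ) (ht : 0 < t) (hs : 0 ≤ s) (hst : s ≤ t) :
      ‖fracHeat α (t + s) f x - fracHeat α t f x‖ ≤ C * D * (s / t) := by
    have h1 := h 𝕜 f hf x hM s t ht hs hst
    rw [hMD, ← ENNReal.ofReal_mul (by positivity), ← ofReal_norm,
      ENNReal.ofReal_le_ofReal_iff (by positivity)] at h1
    linarith
  have hmain := norm_tail_sub_shift_le hlam (mul_nonneg hC hD0) ha hv
    (H := fun t => fracHeat α t f x) hH (M := M) hm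
  rw [← fracHeat_diffTransform hα₀ hα₁ ha.1 (ha.1 m) _ _ hf hM] at hmain
  change ‖diffTransform α a v m M f x - _‖ ≤ _ at hmain
  have hsm := enorm_fracHeat_le hα₀ hα₁ (ha.1 m)
    (aestronglyMeasurable_diffTransform (v := v) hα₀ hα₁ ha.1 (-M) M hf) x
  set G := fracHeat α (a m) (diffTransform α a v (-M) M f) x
  calc ‖diffTransform α a v m M f x‖ₑ = ‖G + (diffTransform α a v m M f x - G)‖ₑ := by
        rw [add_sub_cancel]
    _ ≤ ‖G‖ₑ + ‖diffTransform α a v m M f x - G‖ₑ := enorm_add_le _ _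
    _ ≤ _ := by
        refine add_le_add hsm ?_
        rw [hMD, ← ofReal_norm]
        change _ ≤ ENNReal.ofReal _ * _
        rw [← ENNReal.ofReal_mul hB]
        refine ENNReal.ofReal_le_ofReal (hmain.trans (le_of_eq ?_))
        ring

end DiffTransform

theorem theorem3 (n : ℕ) (hn : 0 < n) (α : ℝ) (hα₀ : 0 < α) (hα₁ : α < 1)
    (lam : ℝ) (hlam : 1 < lam) (V : ℝ) (q : ℝ) (hq : 1 < q) :
    ∃ C : ℝ≥0, ∀ (a v : ℤ → ℝ), IsLacunary lam a → (∀ j, |v j| ≤ V) →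
      ∀ (𝕜 : Type) [RCLike 𝕜] (f : EuclideanSpace ℝ (Fin n) → 𝕜),
        AEStronglyMeasurable f volume →
        ∀ (x : EuclideanSpace ℝ (Fin n)) (M : ℤ), 0 < M →
          maxDiffTransform α a v M f x ≤
            C * (maximalFn (diffTransform α a v (-M) M f) x + maximalFnPow q f x) := by
  have : Nontrivial (EuclideanSpace ℝ (Fin n)) :=
    Module.nontrivial_of_finrank_pos (R := ℝ) (by rwa [finrank_euclideanSpace_fin])
  obtain ⟨B, hB⟩ := exists_enorm_diffTransform_tail_le n hα₀ hα₁ hlam V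
  refine ⟨2 * (1 + B), fun a v ha hv 𝕜 _ f hf x M _ => ?_⟩
  -- In the infinite case the right side is ∞ because the constant 2(1 + B) is nonzero.
  rcases eq_or_ne (maximalFnPow q f x) ∞ with htop | htop
  · rw [htop, add_top, ENNReal.mul_top]
    · exact le_top
    · simp
  have hle := maximalFn_le_maximalFnPow hq.le hf x
  have hM : maximalFn f x ≠ ∞ := ne_top_of_le_ne_top htop hle
  refine iSup₂_le fun N₁ N₂ => iSup₂_le fun h₁ h₁₂ => iSup_le fun h₂ => ?_
  rw [diffTransform_eq_sub (by omega) h₂]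
  have e1 := hB a v ha hv 𝕜 f hf x hM N₁ M h₁
  have e2 := hB a v ha hv 𝕜 f hf x hM (N₂ + 1) M (by omega)
  set P := maximalFn (diffTransform α a v (-M) M f) x
  have e3 : P + B * maximalFn f x ≤ (1 + B) * (P + maximalFnPow q f x) := by
    calc P + B * maximalFn f x ≤ (P + maximalFnPow q f x) + B * (P + maximalFnPow q f x) := by
          gcongr
          · exact le_self_add
          · exact hle.trans le_add_self
      _ = _ := by ring
  calc _ ≤ ‖diffTransform α a v N₁ M f x‖ₑ + ‖diffTransform α a v (N₂ + 1) M f x‖ₑ :=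
        enorm_sub_le
    _ ≤ (1 + B) * (P + maximalFnPow q f x) + (1 + B) * (P + maximalFnPow q f x) :=
        add_le_add (e1.trans e3) (e2.trans e3)
    _ = _ := by
        push_cast
        ring
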